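/- Let $V$ be a finite-dimensional complex vector space with a nondegenerate symmetric bilinear form $\Phi$, and let $\mathrm{O}(V)$ be the group of linear automorphisms of $V$ preserving $\Phi$. Let $C(V)$ be the Clifford algebra, the quotient of the tensor algebra of $V$ by the two-sided ideal generated by the elements $v\otimes v+\Phi(v,v)$, $v\in V$, and let $\mathrm{Pin}(V)$ be the subgroup of $C(V)^\times$ generated by the vectors $u\in V$ with $\Phi(u,u)=1$. Let $\rho:\mathrm{Pin}(V)\to \mathrm{O}(V)$ be the unique homomorphism taking each such $u$ to the reflection $v\mapsto v-2\Phi(u,v)u$. A representation $\pi$ of a finite group $G$ on $V$ that preserves $\Phi$ (an orthogonal representation) is called spinorial if there is a homomorphism $\hat\pi:G\to\mathrm{Pin}(V)$ with $\rho\circ\hat\pi=\pi$. Write $\Theta_\pi(g)=\operatorname{tr}\pi(g)$ for the character of $\pi$; below, $a\equiv b \pmod 8$ means $a-b\in 8\mathbb Z$. (1) The group $\mathrm{GL}_2(\mathbb F_4)$ is isomorphic to $A_5\times C_3$, where $A_5$ is the alternating group and $C_3$ is cyclic of order $3$. For every isomorphism $\mathrm{GL}_2(\mathbb F_4)\cong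 A_5\times C_3$, write $(12)(34)$ also for the element of $\mathrm{GL}_2(\mathbb F_4)$ corresponding to $((12)(34),1)$. Then an orthogonal representation $\pi$ of $\mathrm{GL}_2(\mathbb F_4)$ is spinorial if and only if $$\Theta_\pi(1)\equiv\Theta_\pi((12)(34)) \pmod 8.$$ (2) The group $\mathrm{GL}_4(\mathbb F_2)$ is isomorphic to the alternating group $A_8$. For every isomorphism $\mathrm{GL}_4(\mathbb F_2)\cong A_8$, write $(12)(34)$ also for the corresponding element of $\mathrm{GL}_4(\mathbb F_2)$. Then an orthogonal representation $\pi$ of $\mathrm{GL}_4(\mathbb F_2)$ is spinorial if and only if $$\Theta_\pi(1)\equiv\Theta_\pi((12)(34)) \pmod 8.$$ -/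

import Mathlib

namespace Spinorial

noncomputable section

variable {V : Type*} [AddCommGroup V] [Module ℂ V]

/-- The orthogonal group `O(V)` of a bilinear form `Φ`: the linear automorphisms of `V` that
preserve `Φ`. -/
def orthogonalGroup (Φ : LinearMap.BilinForm ℂ V) : Subgroup (V ≃ₗ[ℂ] V) where
  carrier := {f | ∀ v w, Φ (f v) (f w) = Φ v w}
  mul_mem' := fun {f g} hf hg v w => by
    rw [LinearEquiv.mul_apply, LinearEquiv.mul_apply, hf, hg]
  one_mem' := fun _ _ => rfl
  inv_mem' := fun {f} hf v w => by
    rw [← hf (f⁻¹ v) (f⁻¹ w), ← LinearEquiv.mul_apply, ← LinearEquiv.mul_apply, mul_inv_cancel]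
    rfl

/-- The quadratic form `v ↦ -Φ(v, v)`. -/
abbrev negForm (Φ : LinearMap.BilinForm ℂ V) : QuadraticForm ℂ V :=
  -(LinearMap.BilinMap.toQuadraticMap Φ)

/-- The Clifford algebra `C(V)`, with the sign convention `v * v = -Φ(v, v)`. -/
abbrev Cliff (Φ : LinearMap.BilinForm ℂ V) : Type _ :=
  CliffordAlgebra (negForm Φ)

/-- The inclusion `V → C(V)`. -/
abbrev incl (Φ : LinearMap.BilinForm ℂ V) : V →ₗ[ℂ] Cliff Φ :=
  CliffordAlgebra.ι (negForm Φ)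

/-- The group `Pin(V)`: the subgroup of `C(V)ˣ` generated by the unit vectors, that is by the
`u ∈ V` with `Φ(u, u) = 1`. -/
def Pin (Φ : LinearMap.BilinForm ℂ V) : Subgroup (Cliff Φ)ˣ :=
  Subgroup.closure {x | ∃ u : V, Φ u u = 1 ∧ (x : Cliff Φ) = incl Φ u}

/-- The reflection `v ↦ v - 2 Φ(u, v) u` determined by a unit vector `u`. -/
def reflection (Φ : LinearMap.BilinForm ℂ V) (u : V) (hu : Φ u u = 1) : V ≃ₗ[ℂ] V :=
  Module.reflection (x := u) (f := (2 : ℂ) • Φ u) (by simp [hu])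

theorem reflection_apply (Φ : LinearMap.BilinForm ℂ V) (u : V) (hu : Φ u u = 1) (v : V) :
    reflection Φ u hu v = v - (2 * Φ u v) • u := by
  simp [reflection, Module.reflection_apply]

theorem reflection_mem (Φ : LinearMap.BilinForm ℂ V) (hΦ : Φ.IsSymm) (u : V) (hu : Φ u u = 1) :
    reflection Φ u hu ∈ orthogonalGroup Φ := by
  intro v w
  have h : Φ v u = Φ u v := hΦ.eq v u
  simp only [reflection_apply, map_sub, map_smul, LinearMap.sub_apply, LinearMap.smul_apply,
    smul_eq_mul, hu, h]
  ring

theorem incl_injective (Φ : LinearMap.BilinForm ℂ V) : Function.Injective (incl Φ) := by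
  intro v w h
  have h2 : (LinearMap.BilinMap.toQuadraticMap Φ) = (0 : QuadraticForm ℂ V) - negForm Φ := by
    simp [negForm]
  have h3 := congrArg (CliffordAlgebra.changeForm h2) h
  rw [CliffordAlgebra.changeForm_ι, CliffordAlgebra.changeForm_ι] at h3
  exact (ExteriorAlgebra.ι_inj ℂ v w).1 h3

/-- A unit vector, as an element of `C(V)ˣ`; its inverse is its negative. -/
def unitVector (Φ : LinearMap.BilinForm ℂ V) (u : V) (hu : Φ u u = 1) : (Cliff Φ)ˣ where
  val := incl Φ u
  inv := -incl Φ u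
  val_inv := by simp [hu]
  inv_val := by simp [hu]

theorem unitVector_mem (Φ : LinearMap.BilinForm ℂ V) (u : V) (hu : Φ u u = 1) :
    unitVector Φ u hu ∈ Pin Φ :=
  Subgroup.subset_closure ⟨u, hu, rfl⟩

theorem incl_reflection (Φ : LinearMap.BilinForm ℂ V) (hΦ : Φ.IsSymm) (u : V) (hu : Φ u u = 1)
    (v : V) :
    incl Φ (reflection Φ u hu v) =
      CliffordAlgebra.involute (unitVector Φ u hu : Cliff Φ) * incl Φ v *
        ((unitVector Φ u hu)⁻¹ : (Cliff Φ)ˣ) := by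
  have h1 : incl Φ u * incl Φ u = -1 := by simp [hu]
  have h : Φ v u = Φ u v := hΦ.eq v u
  have h2 : incl Φ u * incl Φ v = algebraMap ℂ (Cliff Φ) (-(2 * Φ u v)) - incl Φ v * incl Φ u := by
    rw [eq_sub_iff_add_eq, CliffordAlgebra.ι_mul_ι_add_swap]
    congr 1
    simp only [QuadraticMap.polar, negForm, neg_apply,
      LinearMap.BilinMap.toQuadraticMap_apply, map_add, LinearMap.add_apply, h]
    ring
  change _ = CliffordAlgebra.involute (incl Φ u) * incl Φ v * (-incl Φ u)
  rw [CliffordAlgebra.involute_ι, neg_mul, neg_mul_neg, h2, sub_mul, mul_assoc, h1,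
    reflection_apply, map_sub, map_smul, ← Algebra.smul_def]
  simp only [mul_neg, mul_one, neg_smul]
  abel

theorem exists_twisted_conj (Φ : LinearMap.BilinForm ℂ V) (hΦ : Φ.IsSymm) (x : (Cliff Φ)ˣ)
    (hx : x ∈ Pin Φ) :
    ∃ f : orthogonalGroup Φ, ∀ v, incl Φ ((f : V ≃ₗ[ℂ] V) v) =
      CliffordAlgebra.involute (x : Cliff Φ) * incl Φ v * (x⁻¹ : (Cliff Φ)ˣ) := by
  induction hx using Subgroup.closure_induction with
  | mem x hx =>
    obtain ⟨u, hu, hxu⟩ := hx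
    obtain rfl : x = unitVector Φ u hu := Units.ext hxu
    exact ⟨⟨reflection Φ u hu, reflection_mem Φ hΦ u hu⟩, incl_reflection Φ hΦ u hu⟩
  | one => exact ⟨1, fun v => by simp⟩
  | mul x y _ _ hx hy =>
    obtain ⟨f, hf⟩ := hx
    obtain ⟨g, hg⟩ := hy
    refine ⟨f * g, fun v => ?_⟩
    rw [Subgroup.coe_mul, LinearEquiv.mul_apply, hf, hg]
    simp only [Units.val_mul, map_mul, mul_inv_rev, mul_assoc]
  | inv x _ hx =>
    obtain ⟨f, hf⟩ := hx
    refine ⟨f⁻¹, fun v => ?_⟩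
    have h := hf (((f⁻¹ : orthogonalGroup Φ) : V ≃ₗ[ℂ] V) v)
    rw [← LinearEquiv.mul_apply, ← Subgroup.coe_mul, mul_inv_cancel] at h
    have h3 : CliffordAlgebra.involute ((x⁻¹ : (Cliff Φ)ˣ) : Cliff Φ) *
        CliffordAlgebra.involute (x : Cliff Φ) = 1 := by
      rw [← map_mul, Units.inv_mul, map_one]
    change incl Φ v = _ at h
    rw [h, inv_inv, ← mul_assoc, ← mul_assoc, h3, one_mul, mul_assoc, Units.inv_mul, mul_one]

/-- The double cover `ρ : Pin(V) → O(V)`, given by `ρ(x) v = α(x) v x⁻¹` with `α` the grading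
involution of `C(V)`. It is the homomorphism that takes a unit vector to its reflection, see
`pinCover_unitVector` and `pinCover_unique`. -/
def pinCover (Φ : LinearMap.BilinForm ℂ V) (hΦ : Φ.IsSymm) : Pin Φ →* orthogonalGroup Φ :=
  MonoidHom.mk' (fun x => (exists_twisted_conj Φ hΦ x.1 x.2).choose) (by
    intro x y
    apply Subtype.ext
    apply LinearEquiv.ext
    intro v
    apply incl_injective Φ
    rw [(exists_twisted_conj Φ hΦ (x * y : Pin Φ).1 (x * y : Pin Φ).2).choose_spec]
    rw [Subgroup.coe_mul (orthogonalGroup Φ), LinearEquiv.mul_apply,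
      (exists_twisted_conj Φ hΦ x.1 x.2).choose_spec,
      (exists_twisted_conj Φ hΦ y.1 y.2).choose_spec]
    simp only [Subgroup.coe_mul, Units.val_mul, map_mul, mul_inv_rev, mul_assoc])

theorem incl_pinCover (Φ : LinearMap.BilinForm ℂ V) (hΦ : Φ.IsSymm) (x : Pin Φ) (v : V) :
    incl Φ ((pinCover Φ hΦ x : V ≃ₗ[ℂ] V) v) =
      CliffordAlgebra.involute ((x : (Cliff Φ)ˣ) : Cliff Φ) * incl Φ v *
        ((x : (Cliff Φ)ˣ)⁻¹ : (Cliff Φ)ˣ) :=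
  (exists_twisted_conj Φ hΦ x.1 x.2).choose_spec v

theorem pinCover_unitVector (Φ : LinearMap.BilinForm ℂ V) (hΦ : Φ.IsSymm) (u : V)
    (hu : Φ u u = 1) :
    (pinCover Φ hΦ ⟨unitVector Φ u hu, unitVector_mem Φ u hu⟩ : V ≃ₗ[ℂ] V) =
      reflection Φ u hu := by
  apply LinearEquiv.ext
  intro v
  apply incl_injective Φ
  rw [incl_pinCover, incl_reflection Φ hΦ]

theorem pinCover_unique (Φ : LinearMap.BilinForm ℂ V) (hΦ : Φ.IsSymm)
    (σ : Pin Φ →* orthogonalGroup Φ)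
    (hσ : ∀ (u : V) (hu : Φ u u = 1),
      (σ ⟨unitVector Φ u hu, unitVector_mem Φ u hu⟩ : V ≃ₗ[ℂ] V) = reflection Φ u hu) :
    σ = pinCover Φ hΦ := by
  apply MonoidHom.ext
  rintro ⟨x, hx⟩
  induction hx using Subgroup.closure_induction with
  | mem x hx =>
    obtain ⟨u, hu, hxu⟩ := hx
    obtain rfl : x = unitVector Φ u hu := Units.ext hxu
    exact Subtype.ext ((hσ u hu).trans (pinCover_unitVector Φ hΦ u hu).symm)
  | one => exact (map_one σ).trans (map_one (pinCover Φ hΦ)).symm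
  | mul x y hx hy h1 h2 =>
    have h := congrArg₂ (· * ·) h1 h2
    simp only [← map_mul] at h
    exact h
  | inv x hx h1 =>
    have h := congrArg (·⁻¹) h1
    simp only [← map_inv] at h
    exact h

/-- The representation `π` preserves the form `Φ`. -/
def Preserves {G : Type*} [Group G] (Φ : LinearMap.BilinForm ℂ V) (π : Representation ℂ G V) :
    Prop :=
  ∀ g v w, Φ (π g v) (π g w) = Φ v w

/-- The representation `π`, orthogonal with respect to `Φ`, is spinorial: there is a homomorphism
`π' : G → Pin(V)` with `ρ ∘ π' = π`. -/
def IsSpinorial {G : Type*} [Group G] (Φ : LinearMap.BilinForm ℂ V) (hΦ : Φ.IsSymm)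
    (π : Representation ℂ G V) : Prop :=
  ∃ π' : G →* Pin Φ, ∀ g v, (pinCover Φ hΦ (π' g) : V ≃ₗ[ℂ] V) v = π g v

end

/-- The permutation `(12)(34)`, as an element of the alternating group of `Fin n`; the points
`1, 2, 3, 4` are the elements `0, 1, 2, 3` of `Fin n`. -/
def doubleTransposition (n : ℕ) (hn : 4 ≤ n) : alternatingGroup (Fin n) :=
  ⟨Equiv.swap (⟨0, by omega⟩ : Fin n) ⟨1, by omega⟩ *
      Equiv.swap (⟨2, by omega⟩ : Fin n) ⟨3, by omega⟩, by
    have h1 : (⟨0, by omega⟩ : Fin n) ≠ ⟨1, by omega⟩ := by simp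
    have h2 : (⟨2, by omega⟩ : Fin n) ≠ ⟨3, by omega⟩ := by simp
    rw [Equiv.Perm.mem_alternatingGroup, map_mul, Equiv.Perm.sign_swap h1,
      Equiv.Perm.sign_swap h2]
    rfl⟩

end Spinorial

/-! The kernel of `pinCover` is central of exponent two, and every orthogonal map lifts
(`sq_eq_one_of_pinCover_eq_one`, `commute_of_pinCover_eq_one`, `pinCover_surjective`). So
spinoriality is a lifting problem along a central extension.

Carmichael presents the alternating group by generators of order 3 whose pairwise products are
involutions (`CarmichaelRel.exists_hom`). An element of order 3 has a lift of order 3, and all the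
products are conjugate to (12)(34). The only obstruction is therefore whether a lift of the image of
(12)(34) squares to 1 (`exists_lift_alternatingGroup`). A direct factor C₃ has odd order and adds no
obstruction (`exists_lift_prod_zmod_three`).

An orthogonal involution with (-1)-eigenspace of dimension m lifts to a product of m orthonormal
vectors, whose square is (-1)^(m(m+1)/2) (`exists_pin_of_involution`). As (12)(34) is a product of
two elements of order 3, its image has determinant 1 and m = 2n. The square is then (-1)^n, while
the difference of the two character values is 2m = 4n; both conditions say that n is even.

The group isomorphisms come from explicit matrices satisfying Carmichael's relations, simplicity of
the alternating group, and a comparison of orders. -/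

namespace Spinorial

open Equiv Equiv.Perm

/-! ### Coset enumeration for Carmichael's relations -/

/-- Carmichael's relations for the alternating group: each `x i` has cube `1`, and the product of
any two distinct ones has square `1`. -/
def CarmichaelRel {ι G : Type*} [Group G] (x : ι → G) : Prop :=
  (∀ i, x i ^ 3 = 1) ∧ ∀ i j, i ≠ j → (x i * x j) ^ 2 = 1

section Carmichael

variable {G : Type*} [Group G]

theorem CarmichaelRel.comp {ι κ : Type*} {x : ι → G} (hx : CarmichaelRel x) {f : κ → ι}
    (hf : Function.Injective f) : CarmichaelRel (x ∘ f) :=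
  ⟨fun _ => hx.1 _, fun _ _ hij => hx.2 _ _ fun h => hij (hf h)⟩

theorem CarmichaelRel.inv_eq {ι : Type*} {x : ι → G} (hx : CarmichaelRel x) (i : ι) :
    (x i)⁻¹ = x i * x i :=
  inv_eq_of_mul_eq_one_right (by rw [← hx.1 i, pow_succ', sq])

theorem CarmichaelRel.mul_eq {ι : Type*} {x : ι → G} (hx : CarmichaelRel x) {i j : ι}
    (hij : i ≠ j) : x i * x j = (x j)⁻¹ * (x i)⁻¹ := by
  rw [← mul_inv_rev]
  exact eq_inv_of_mul_eq_one_left (by rw [← sq, hx.2 i j hij])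

/-- Representatives of the right cosets of the subgroup generated by all but the last of the
elements `x i`. -/
def cosetRep {m : ℕ} (x : Fin (m + 1) → G) : Fin 3 ⊕ Fin m → G :=
  Sum.elim ![1, x (Fin.last m), (x (Fin.last m))⁻¹]
    fun i => (x (Fin.last m))⁻¹ * x i.castSucc

/-- With H the subgroup and a the last generator, right multiplication acts on the cosets as
three-cycles: a cycles H, Ha, Ha⁻¹, and x_j cycles Ha, Ha⁻¹, Ha⁻¹x_j, all other cosets being fixed.
Everything follows from x⁻¹ = x² and x_i x_j = x_j⁻¹ x_i⁻¹. -/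
theorem exists_cosetRep_mul {m : ℕ} {x : Fin (m + 1) → G} (hx : CarmichaelRel x)
    (r : Fin 3 ⊕ Fin m) (i : Fin (m + 1)) :
    ∃ h ∈ Subgroup.closure (Set.range (x ∘ Fin.castSucc)), ∃ s,
      cosetRep x r * x i = h * cosetRep x s := by
  have mem (j : Fin m) : x j.castSucc ∈ Subgroup.closure (Set.range (x ∘ Fin.castSucc)) :=
    Subgroup.subset_closure ⟨j, rfl⟩
  have hne (j : Fin m) : j.castSucc ≠ Fin.last m := (Fin.castSucc_lt_last j).ne
  set a := x (Fin.last m) with ha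
  have ha2 : a⁻¹ = a * a := hx.inv_eq _
  rcases Fin.eq_castSucc_or_eq_last i with ⟨j, rfl⟩ | rfl
  · have h1 : a * x j.castSucc = (x j.castSucc)⁻¹ * a⁻¹ := hx.mul_eq (hne j).symm
    rcases r with r | k
    · fin_cases r
      · exact ⟨x j.castSucc, mem j, Sum.inl 0, by simp [cosetRep]⟩
      · exact ⟨(x j.castSucc)⁻¹, inv_mem (mem j), Sum.inl 2, by simpa [cosetRep] using h1⟩
      · exact ⟨1, one_mem _, Sum.inr j, by simp [cosetRep, ← ha]⟩
    · have h2 : x k.castSucc * a = a⁻¹ * (x k.castSucc)⁻¹ := hx.mul_eq (hne k)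
      have h3 : a * x k.castSucc = (x k.castSucc)⁻¹ * a⁻¹ := hx.mul_eq (hne k).symm
      by_cases hkj : k = j
      · subst hkj
        refine ⟨x k.castSucc, mem k, Sum.inl 1, ?_⟩
        simp [cosetRep, ← ha, h2, mul_assoc, hx.inv_eq k.castSucc]
      · have h4 : x k.castSucc * x j.castSucc = (x j.castSucc)⁻¹ * (x k.castSucc)⁻¹ :=
          hx.mul_eq (by simpa using hkj)
        have h5 : x j.castSucc * a = a⁻¹ * (x j.castSucc)⁻¹ := hx.mul_eq (hne j)
        refine ⟨x j.castSucc * (x k.castSucc)⁻¹,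
          mul_mem (mem j) (inv_mem (mem k)), Sum.inr k, ?_⟩
        simp only [cosetRep, Sum.elim_inr, ← ha]
        rw [mul_assoc, h4, ← mul_assoc, ← h5, hx.inv_eq k.castSucc, mul_assoc, ← mul_assoc a, h3,
          ← hx.inv_eq k.castSucc]
        simp only [mul_assoc]
  · rcases r with r | k
    · fin_cases r
      · exact ⟨1, one_mem _, Sum.inl 1, by simp [cosetRep]⟩
      · exact ⟨1, one_mem _, Sum.inl 2, by simp [cosetRep, ← ha, ha2]⟩
      · exact ⟨1, one_mem _, Sum.inl 0, by simp [cosetRep, ← ha]⟩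
    · have h2 : x k.castSucc * a = a⁻¹ * (x k.castSucc)⁻¹ := hx.mul_eq (hne k)
      have h3 : a * x k.castSucc = (x k.castSucc)⁻¹ * a⁻¹ := hx.mul_eq (hne k).symm
      refine ⟨(x k.castSucc)⁻¹, inv_mem (mem k), Sum.inr k, ?_⟩
      have h4 : a⁻¹ * a⁻¹ = a := by rw [← mul_inv_rev, ← ha2, inv_inv]
      simp only [cosetRep, Sum.elim_inr, ← ha]
      rw [mul_assoc, h2, ← mul_assoc, h4, hx.inv_eq k.castSucc, ← mul_assoc, h3,
        ← hx.inv_eq k.castSucc, mul_assoc]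

/-- The union of these cosets contains 1 and is stable under right multiplication by each generator,
hence also by its inverse, which is its square. -/
theorem closure_subset_cosets {m : ℕ} {x : Fin (m + 1) → G} (hx : CarmichaelRel x) :
    (Subgroup.closure (Set.range x) : Set G) ⊆
      Set.image2 (· * ·) (Subgroup.closure (Set.range (x ∘ Fin.castSucc)))
        (Set.range (cosetRep x)) := by
  have step : ∀ g ∈ Set.image2 (· * ·)
      (Subgroup.closure (Set.range (x ∘ Fin.castSucc)) : Set G) (Set.range (cosetRep x)),
      ∀ i, g * x i ∈ Set.image2 (· * ·)
      (Subgroup.closure (Set.range (x ∘ Fin.castSucc)) : Set G) (Set.range (cosetRep x)) := by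
    rintro _ ⟨h, hh, _, ⟨r, rfl⟩, rfl⟩ i
    obtain ⟨h', hh', s, e⟩ := exists_cosetRep_mul hx r i
    exact ⟨h * h', mul_mem hh hh', _, ⟨s, rfl⟩, by simp only [mul_assoc, e]⟩
  intro g hg
  induction hg using Subgroup.closure_induction_right with
  | one => exact ⟨1, one_mem _, _, ⟨Sum.inl 0, rfl⟩, by simp [cosetRep]⟩
  | mul_right g _ y hy ih =>
    obtain ⟨i, rfl⟩ := hy
    exact step _ ih i
  | mul_inv_cancel g _ y hy ih =>
    obtain ⟨i, rfl⟩ := hy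
    rw [hx.inv_eq, ← mul_assoc]
    exact step _ (step _ ih i) i

/-- Elements that satisfy Carmichael's relations generate a group of order at most `(m + 2)! / 2`. -/
theorem CarmichaelRel.two_mul_ncard_le {m : ℕ} {x : Fin m → G} (hx : CarmichaelRel x) :
    (Subgroup.closure (Set.range x) : Set G).Finite ∧
      2 * (Subgroup.closure (Set.range x) : Set G).ncard ≤ (m + 2).factorial := by
  induction m with
  | zero => simp
  | succ m ih =>
    obtain ⟨hfin, hcard⟩ := ih (hx.comp (Fin.castSucc_injective m))
    have hr : (Set.range (cosetRep x)).Finite := Set.finite_range _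
    have hrc : (Set.range (cosetRep x)).ncard ≤ m + 3 := by
      rw [← Set.image_univ]
      refine (Set.ncard_image_le Set.finite_univ).trans ?_
      simp [Set.ncard_univ, add_comm]
    have hS := hfin.image2 (· * ·) hr
    refine ⟨hS.subset (closure_subset_cosets hx), ?_⟩
    have h1 := Set.ncard_le_ncard (closure_subset_cosets hx) hS
    have h2 : (Set.image2 (· * ·) (Subgroup.closure (Set.range (x ∘ Fin.castSucc)) : Set G)
        (Set.range (cosetRep x))).ncard ≤
        (Subgroup.closure (Set.range (x ∘ Fin.castSucc)) : Set G).ncard *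
          (Set.range (cosetRep x)).ncard := by
      rw [← Set.image_uncurry_prod, ← Set.ncard_prod]
      exact Set.ncard_image_le (hfin.prod hr)
    rw [Nat.factorial_succ]
    calc _ ≤ 2 * ((Subgroup.closure (Set.range (x ∘ Fin.castSucc)) : Set G).ncard * (m + 3)) := by
          gcongr
          exact h1.trans (h2.trans (by gcongr))
      _ = (m + 3) *
          (2 * (Subgroup.closure (Set.range (x ∘ Fin.castSucc)) : Set G).ncard) := by ring
      _ ≤ _ := by gcongr

end Carmichael

/-! ### Star three-cycles and the presentation of the alternating group -/

/-- The three-cycle `0 ↦ 1 ↦ i + 2 ↦ 0`. -/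
def starCycle {m : ℕ} (i : Fin m) : alternatingGroup (Fin (m + 2)) :=
  ⟨swap 0 i.succ.succ * swap 0 1, by
    rw [mem_alternatingGroup, map_mul, sign_swap (Fin.succ_ne_zero _).symm,
      sign_swap (by simp)]
    rfl⟩

theorem coe_starCycle {m : ℕ} (i : Fin m) :
    (starCycle i : Perm (Fin (m + 2))) = swap 0 i.succ.succ * swap 0 1 := rfl

theorem succ_succ_ne_one {m : ℕ} (i : Fin m) : i.succ.succ ≠ 1 := by
  simp [Fin.ext_iff]

theorem starCycle_zero {m : ℕ} (i : Fin m) : (starCycle i).1 0 = 1 := by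
  simp [coe_starCycle, swap_apply_of_ne_of_ne (one_ne_zero) (succ_succ_ne_one i).symm]

theorem starCycle_one {m : ℕ} (i : Fin m) : (starCycle i).1 1 = i.succ.succ := by
  simp [coe_starCycle]

theorem starCycle_self {m : ℕ} (i : Fin m) : (starCycle i).1 i.succ.succ = 0 := by
  simp [coe_starCycle, swap_apply_of_ne_of_ne (Fin.succ_ne_zero _) (succ_succ_ne_one i)]

theorem starCycle_of_ne {m : ℕ} {i : Fin m} {p : Fin (m + 2)} (h0 : p ≠ 0) (h1 : p ≠ 1)
    (hi : p ≠ i.succ.succ) : (starCycle i).1 p = p := by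
  simp [coe_starCycle, swap_apply_of_ne_of_ne h0 h1, swap_apply_of_ne_of_ne h0 hi]

theorem starCycle_mul {m : ℕ} {i j : Fin m} (hij : i ≠ j) :
    (starCycle i * starCycle j : Perm (Fin (m + 2))) =
      swap 0 i.succ.succ * swap 1 j.succ.succ := by
  have hij' : j.succ.succ ≠ i.succ.succ := by simpa using hij.symm
  rw [coe_starCycle i, coe_starCycle j, mul_assoc]
  congr 1
  ext p
  simp only [Perm.mul_apply, swap_apply_def]
  have := succ_succ_ne_one j
  have := Fin.succ_ne_zero j.succ
  have : (0 : Fin (m + 2)) ≠ 1 := by simp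
  grind

theorem disjoint_starCycle_swaps {m : ℕ} {i j : Fin m} (hij : i ≠ j) :
    Disjoint (swap 0 i.succ.succ : Perm (Fin (m + 2))) (swap 1 j.succ.succ) := by
  have hij' : j.succ.succ ≠ i.succ.succ := by simpa using hij.symm
  rw [disjoint_iff_eq_or_eq]
  intro p
  have := succ_succ_ne_one i
  have := Fin.succ_ne_zero j.succ
  have : (0 : Fin (m + 2)) ≠ 1 := by simp
  simp only [swap_apply_def]
  grind

theorem carmichaelRel_starCycle (m : ℕ) :
    CarmichaelRel (starCycle : Fin m → alternatingGroup (Fin (m + 2))) := by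
  refine ⟨fun i => ?_, fun i j hij => ?_⟩
  · have h := isThreeCycle_swap_mul_swap_same (a := (0 : Fin (m + 2))) (b := i.succ.succ) (c := 1)
      (Fin.succ_ne_zero _).symm (by simp) (succ_succ_ne_one i)
    apply Subtype.ext
    rw [Subgroup.coe_pow, coe_starCycle, Subgroup.coe_one, ← h.orderOf, pow_orderOf_eq_one]
  · apply Subtype.ext
    rw [Subgroup.coe_pow, Subgroup.coe_mul, starCycle_mul hij, Subgroup.coe_one,
      (disjoint_starCycle_swaps hij).commute.mul_pow]
    simp [sq]

/-- Induction on the number of points that may move: a word in the star cycles brings the image of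
the last such point back, leaving a permutation with one point fewer to move. -/
theorem mem_closure_starCycle {m : ℕ} (k : ℕ) (hk : k ≤ m) (σ : alternatingGroup (Fin (m + 2)))
    (hσ : ∀ p : Fin (m + 2), k + 2 ≤ p.val → σ.1 p = p) :
    σ ∈ Subgroup.closure (Set.range (starCycle : Fin m → _)) := by
  induction k generalizing σ with
  | zero =>
    have h01 : (0 : Fin (m + 2)) ≠ 1 := by simp
    have hp (p : Fin (m + 2)) : p = 0 ∨ p = 1 ∨ σ.1 p = p := by
      by_cases h : 2 ≤ p.val
      · exact Or.inr (Or.inr (hσ p (by simpa using h)))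
      · simp only [Fin.ext_iff, Fin.val_zero, Fin.val_one]
        omega
    have hinj := σ.1.injective
    by_cases h0 : σ.1 0 = 0
    · have : σ = 1 := by
        apply Subtype.ext
        ext p : 1
        simp only [Subgroup.coe_one, Perm.one_apply]
        rcases hp p with rfl | rfl | h
        · exact h0
        · rcases hp (σ.1 1) with h | h | h
          · exact absurd (hinj (h.trans h0.symm)) h01.symm
          · exact h
          · exact hinj h
        · exact h
      rw [this]
      exact one_mem _
    -- Only 0 and 1 can move, so a nontrivial σ would be a transposition, which is odd.
    · exfalso
      have h1 : σ.1 0 = 1 := by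
        rcases hp (σ.1 0) with h | h | h
        · exact absurd h h0
        · exact h
        · exact absurd (hinj h) h0
      have h2 : σ.1 1 = 0 := by
        rcases hp (σ.1 1) with h | h | h
        · exact h
        · exact absurd (hinj (h1.trans h.symm)) h01
        · exact absurd (hinj (h1.trans (hinj h).symm)) h01
      have h3 : σ.1 = swap 0 1 := by
        ext p : 1
        rcases hp p with rfl | rfl | h
        · simpa using h1
        · simpa using h2
        · by_cases p0 : p = 0
          · subst p0; simpa using h1
          · by_cases p1 : p = 1
            · subst p1; simpa using h2
            · rw [h, swap_apply_of_ne_of_ne p0 p1]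
      have h4 := σ.2
      rw [mem_alternatingGroup, h3, sign_swap h01] at h4
      exact absurd h4 (by decide)
  | succ k ih =>
    set l : Fin m := ⟨k, by omega⟩ with hl
    have hlv : l.succ.succ.val = k + 2 := by simp [hl]
    -- The word depends on where σ sends the point: from 1 one star cycle suffices, from 0 its
    -- square, and from i + 2 the square of the i-th cycle first carries the image to 1.
    have key : ∃ h ∈ Subgroup.closure (Set.range (starCycle : Fin m → _)),
        h.1 (σ.1 l.succ.succ) = l.succ.succ ∧
          ∀ p : Fin (m + 2), k + 3 ≤ p.val → h.1 p = p := by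
      have hfix (i : Fin m) (hi : i ≤ l) (p : Fin (m + 2)) (hp : k + 3 ≤ p.val) :
          (starCycle i).1 p = p := by
        refine starCycle_of_ne ?_ ?_ ?_ <;> rintro rfl
        · simp at hp
        · simp at hp
        · simp only [Fin.val_succ] at hp
          have : i.val ≤ k := hi
          omega
      have mem (i : Fin m) : starCycle i ∈ Subgroup.closure (Set.range (starCycle : Fin m → _)) :=
        Subgroup.subset_closure ⟨i, rfl⟩
      have hlt : (σ.1 l.succ.succ).val < k + 3 := by
        by_contra hcon
        have h2 := σ.1.injective (hσ (σ.1 l.succ.succ) (by omega))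
        rw [h2, hlv] at hcon
        omega
      generalize σ.1 l.succ.succ = q at hlt
      induction q using Fin.cases with
      | zero =>
        refine ⟨starCycle l * starCycle l, mul_mem (mem l) (mem l), ?_, fun p hp => ?_⟩
        · simp [starCycle_zero, starCycle_one]
        · simp [hfix l le_rfl p hp]
      | succ q =>
        induction q using Fin.cases with
        | zero => exact ⟨starCycle l, mem l, starCycle_one l, hfix l le_rfl⟩
        | succ i =>
          have hil : i ≤ l := by
            simp only [Fin.val_succ] at hlt
            change i.val ≤ k
            omega
          refine ⟨starCycle l * (starCycle i * starCycle i),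
            mul_mem (mem l) (mul_mem (mem i) (mem i)), ?_, fun p hp => ?_⟩
          · simp [starCycle_self, starCycle_zero, starCycle_one]
          · simp [hfix l le_rfl p hp, hfix i hil p hp]
    obtain ⟨h, hh, h1, h2⟩ := key
    have h3 := ih (by omega) (h * σ) fun p hp => by
      rcases hp.eq_or_lt with e | e
      · have : p = l.succ.succ := Fin.ext (by rw [hlv, e])
        subst this
        simpa using h1
      · have e' : k + 3 ≤ p.val := e
        simp [hσ p (by omega), h2 p e']
    simpa using mul_mem (inv_mem hh) h3

theorem closure_starCycle (m : ℕ) :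
    Subgroup.closure (Set.range (starCycle : Fin m → _)) = ⊤ :=
  eq_top_iff.2 fun σ _ => mem_closure_starCycle m le_rfl σ fun p hp => absurd p.2 (by omega)

/-- The star three-cycles and Carmichael's relations present the alternating group. -/
theorem CarmichaelRel.exists_hom {G : Type*} [Group G] {m : ℕ} {x : Fin m → G}
    (hx : CarmichaelRel x) :
    ∃ f : alternatingGroup (Fin (m + 2)) →* G, ∀ i, f (starCycle i) = x i := by
  -- The pairs generate the graph of the desired homomorphism. They satisfy the relations too, so
  -- the graph has at most (m + 2)!/2 elements, and its surjective projection to the alternating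
  -- group is bijective.
  let y : Fin m → alternatingGroup (Fin (m + 2)) × G := fun i => (starCycle i, x i)
  have hy : CarmichaelRel y :=
    ⟨fun i => Prod.ext ((carmichaelRel_starCycle m).1 i) (hx.1 i),
      fun i j hij => Prod.ext ((carmichaelRel_starCycle m).2 i j hij) (hx.2 i j hij)⟩
  obtain ⟨hfin, hcard⟩ := hy.two_mul_ncard_le
  set K := Subgroup.closure (Set.range y) with hK
  have : Finite K := hfin.to_subtype
  let p : K →* alternatingGroup (Fin (m + 2)) := (MonoidHom.fst _ _).comp K.subtype
  have hmem (i : Fin m) : y i ∈ K := Subgroup.subset_closure ⟨i, rfl⟩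
  have hsurj : Function.Surjective p := by
    rw [← MonoidHom.range_eq_top, eq_top_iff, ← closure_starCycle m, Subgroup.closure_le]
    rintro _ ⟨i, rfl⟩
    exact ⟨⟨y i, hmem i⟩, rfl⟩
  have hbij : Function.Bijective p := by
    refine (Nat.bijective_iff_surjective_and_card _).2 ⟨hsurj, le_antisymm ?_ ?_⟩
    · have h1 : 2 * Nat.card (alternatingGroup (Fin (m + 2))) = (m + 2).factorial := by
        rw [two_mul_nat_card_alternatingGroup, Nat.card_perm, Nat.card_fin]
      have h2 : Nat.card K = (K : Set (alternatingGroup (Fin (m + 2)) × G)).ncard :=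
        Nat.card_coe_set_eq _
      omega
    · exact Nat.card_le_card_of_surjective p hsurj
  let e := MulEquiv.ofBijective p hbij
  refine ⟨(MonoidHom.snd _ _).comp (K.subtype.comp e.symm.toMonoidHom), fun i => ?_⟩
  have : e.symm (starCycle i) = ⟨y i, hmem i⟩ := by
    rw [MulEquiv.symm_apply_eq]
    rfl
  simp [this, y]

theorem cycleType_swap_mul_swap {α : Type*} [Fintype α] [DecidableEq α] {a b c d : α}
    (hab : a ≠ b) (hcd : c ≠ d) (h : Disjoint (swap a b) (swap c d)) :
    (swap a b * swap c d).cycleType = {2, 2} := by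
  rw [h.cycleType_mul, (swap_isSwap_iff.2 hab).isCycle.cycleType,
    (swap_isSwap_iff.2 hcd).isCycle.cycleType, card_support_swap hab, card_support_swap hcd]
  rfl

theorem disjoint_doubleTransposition_swaps {n : ℕ} (hn : 4 ≤ n) :
    Disjoint (swap (⟨0, by omega⟩ : Fin n) ⟨1, by omega⟩)
      (swap (⟨2, by omega⟩ : Fin n) ⟨3, by omega⟩) := by
  rw [disjoint_iff_eq_or_eq]
  intro p
  simp only [swap_apply_def, Fin.ext_iff]
  split_ifs <;> simp_all

theorem isConj_doubleTransposition {m : ℕ} (hm : 4 ≤ m + 2) {i j : Fin m} (hij : i ≠ j) :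
    IsConj (doubleTransposition (m + 2) hm) (starCycle i * starCycle j) := by
  have hd := disjoint_doubleTransposition_swaps hm
  have h1 : (doubleTransposition (m + 2) hm).1.cycleType = {2, 2} :=
    cycleType_swap_mul_swap (by simp) (by simp) hd
  have h2 : (starCycle i * starCycle j).1.cycleType = {2, 2} := by
    rw [Subgroup.coe_mul, starCycle_mul hij]
    exact cycleType_swap_mul_swap (Fin.succ_ne_zero _).symm (succ_succ_ne_one j).symm
      (disjoint_starCycle_swaps hij)
  obtain ⟨c, hc⟩ := isConj_iff.1 (isConj_iff_cycleType_eq.2 (h1.trans h2.symm))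
  rw [isConj_iff]
  rcases Int.units_eq_one_or (sign c) with hs | hs
  · exact ⟨⟨c, mem_alternatingGroup.2 hs⟩, Subtype.ext hc⟩
  -- An odd conjugator is corrected by the transposition (12), which commutes with (12)(34).
  · set s : Perm (Fin (m + 2)) := swap ⟨0, by omega⟩ ⟨1, by omega⟩ with hs'
    refine ⟨⟨c * s, ?_⟩, Subtype.ext ?_⟩
    · rw [mem_alternatingGroup, map_mul, hs, sign_swap (by simp)]
      rfl
    · have hcomm : s * (doubleTransposition (m + 2) hm).1 * s⁻¹ =
          (doubleTransposition (m + 2) hm).1 := by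
        rw [mul_inv_eq_iff_eq_mul]
        change s * (s * _) = (s * _) * s
        rw [mul_assoc, hd.commute.eq]
      change c * s * (doubleTransposition (m + 2) hm).1 * (c * s)⁻¹ = _
      rw [← hc]
      nth_rw 2 [← hcomm]
      simp only [mul_inv_rev, mul_assoc]

/-! ### Lifting along central extensions by groups of exponent two -/

section Lifting

variable {P O : Type*} [Group P] [Group O] {ρ : P →* O}

/-- For any lift y, the cube y³ lies in the kernel, so y¹² = 1, and y⁴ is still a lift because g⁴ =
g. -/
theorem exists_lift_of_cube_eq_one (hρ : Function.Surjective ρ) (hk : ∀ z, ρ z = 1 → z ^ 2 = 1)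
    {g : O} (hg : g ^ 3 = 1) : ∃ y, ρ y = g ∧ y ^ 3 = 1 := by
  obtain ⟨y, rfl⟩ := hρ g
  refine ⟨y ^ 4, by rw [map_pow, pow_succ, hg, one_mul], ?_⟩
  have := hk (y ^ 3) (by rw [map_pow, hg])
  rw [← pow_mul] at this ⊢
  rw [show 4 * 3 = (3 * 2) * 2 from rfl, pow_mul, this, one_pow]

/-- A homomorphism from an alternating group lifts along a central extension by a group of
exponent two as soon as some lift of a double transposition is an involution. -/
theorem exists_lift_alternatingGroup (hρ : Function.Surjective ρ)
    (hk : ∀ z, ρ z = 1 → z ^ 2 = 1) (hc : ∀ z, ρ z = 1 → ∀ y, Commute z y) {m : ℕ}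
    (hm : 4 ≤ m + 2) (π : alternatingGroup (Fin (m + 2)) →* O) {s : P}
    (hs : ρ s = π (doubleTransposition (m + 2) hm)) (hs2 : s ^ 2 = 1) :
    ∃ π' : alternatingGroup (Fin (m + 2)) →* P, ρ.comp π' = π := by
  have hx (i : Fin m) : ∃ y, ρ y = π (starCycle i) ∧ y ^ 3 = 1 :=
    exists_lift_of_cube_eq_one hρ hk (by
      rw [← map_pow, (carmichaelRel_starCycle m).1, map_one])
  choose x hx1 hx3 using hx
  have hrel : CarmichaelRel x := by
    refine ⟨hx3, fun i j hij => ?_⟩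
    obtain ⟨c, hc'⟩ := isConj_iff.1 (isConj_doubleTransposition hm hij)
    obtain ⟨y, hy⟩ := hρ (π c)
    -- The product differs from a conjugate of s by a kernel element, which is central of square 1,
    -- so it inherits its square from s.
    have h1 : ρ (x i * x j * (y * s * y⁻¹)⁻¹) = 1 := by
      rw [map_mul, map_mul, map_inv, map_mul, map_mul, map_inv, hx1, hx1, hs, hy,
        ← map_mul, ← map_inv, ← map_mul, ← map_mul, hc', mul_inv_cancel]
    have h2 : x i * x j = (x i * x j * (y * s * y⁻¹)⁻¹) * (y * s * y⁻¹) := by group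
    rw [h2, (hc _ h1 _).mul_pow, hk _ h1, one_mul, conj_pow, hs2, mul_one, mul_inv_cancel]
  obtain ⟨π', hπ'⟩ := hrel.exists_hom
  refine ⟨π', ?_⟩
  apply MonoidHom.eq_of_eqOn_dense (closure_starCycle m)
  rintro _ ⟨i, rfl⟩
  simp [hπ', hx1]

theorem exists_eq_ofAdd_one_pow (d : Multiplicative (ZMod 3)) :
    ∃ k < 3, d = Multiplicative.ofAdd (1 : ZMod 3) ^ k := by
  have h : ∀ d : Multiplicative (ZMod 3), ∃ k : Fin 3,
      d = Multiplicative.ofAdd (1 : ZMod 3) ^ (k : ℕ) := by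
    decide
  obtain ⟨k, hk⟩ := h d
  exact ⟨k, k.2, hk⟩

/-- A homomorphism from `G × C₃` is given by one from `G` and an element with cube `1` that
commutes with its image. -/
theorem exists_hom_prod_zmod_three {G : Type*} [Group G] (f : G →* P) {y : P} (hy3 : y ^ 3 = 1)
    (hcomm : ∀ g, Commute (f g) y) :
    ∃ F : G × Multiplicative (ZMod 3) →* P,
      ∀ g (k : ℕ), F (g, Multiplicative.ofAdd (1 : ZMod 3) ^ k) = f g * y ^ k := by
  have hy3' : zmultiplesHom (Additive P) (Additive.ofMul y) ((3 : ℕ) : ℤ) = 0 := by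
    rw [zmultiplesHom_apply, natCast_zsmul, ← ofMul_pow, hy3, ofMul_one]
  let h : Multiplicative (ZMod 3) →* P :=
    AddMonoidHom.toMultiplicativeLeft (ZMod.lift 3 ⟨_, hy3'⟩)
  have hh : h (Multiplicative.ofAdd (1 : ZMod 3)) = y := by
    change Additive.toMul (ZMod.lift 3 ⟨_, hy3'⟩ (1 : ZMod 3)) = y
    rw [← Int.cast_one, ZMod.lift_coe]
    simp
  have hcomm' (g : G) (d : Multiplicative (ZMod 3)) : Commute (f g) (h d) := by
    obtain ⟨k, -, rfl⟩ := exists_eq_ofAdd_one_pow d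
    rw [map_pow, hh]
    exact (hcomm g).pow_right k
  exact ⟨MonoidHom.noncommCoprod f h hcomm', fun g k => by
    rw [MonoidHom.noncommCoprod_apply, map_pow, hh]⟩

/-- Along a central extension by a group of exponent two, a homomorphism from `G × C₃` lifts as
soon as its restriction to `G` does. -/
theorem exists_lift_prod_zmod_three (hρ : Function.Surjective ρ)
    (hk : ∀ z, ρ z = 1 → z ^ 2 = 1) (hc : ∀ z, ρ z = 1 → ∀ y, Commute z y) {G : Type*} [Group G]
    (π : G × Multiplicative (ZMod 3) →* O) (f : G →* P)
    (hf : ρ.comp f = π.comp (MonoidHom.inl _ _)) :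
    ∃ π' : G × Multiplicative (ZMod 3) →* P, ρ.comp π' = π := by
  set c : Multiplicative (ZMod 3) := Multiplicative.ofAdd 1 with hcdef
  have hc3 : c ^ 3 = 1 := by decide
  have hfg (g : G) : ρ (f g) = π (g, 1) := DFunLike.congr_fun hf g
  obtain ⟨y, hy, hy3⟩ := exists_lift_of_cube_eq_one hρ hk (g := π (1, c)) (by
    rw [← map_pow, Prod.pow_mk, one_pow, hc3]; exact map_one π)
  have hcomm (g : G) : Commute (f g) y := by
    -- The commutator w is central with w² = 1. Since wy is conjugate to y, its cube is 1; but (wy)³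
    -- = w³y³ = w.
    set w := f g * y * (f g)⁻¹ * y⁻¹ with hw
    have hw1 : ρ w = 1 := by
      have h1 : (π (g, 1)) * π (1, c) = π (1, c) * π (g, 1) := by
        rw [← map_mul, ← map_mul]; simp
      simp only [hw, map_mul, map_inv, hfg, hy, h1]
      group
    have h2 : f g * y * (f g)⁻¹ = w * y := by rw [hw]; group
    have h3 : (w * y) ^ 3 = 1 := by rw [← h2, conj_pow, hy3, mul_one, mul_inv_cancel]
    rw [(hc w hw1 y).mul_pow, hy3, mul_one, pow_succ, hk w hw1, one_mul] at h3
    rw [h3, one_mul] at h2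
    exact mul_inv_eq_iff_eq_mul.1 h2
  obtain ⟨F, hF⟩ := exists_hom_prod_zmod_three f hy3 hcomm
  refine ⟨F, MonoidHom.ext ?_⟩
  rintro ⟨g, d⟩
  obtain ⟨k, -, rfl⟩ := exists_eq_ofAdd_one_pow d
  rw [MonoidHom.comp_apply, hF, map_mul, hfg, map_pow, hy, ← map_pow, ← map_mul]
  simp [hcdef]

end Lifting

/-! ### The isomorphisms of GL₄(𝔽₂) and GL₂(𝔽₄) -/

/-- Simplicity of the alternating group on at least five points leaves no other kernel. -/
theorem injective_of_starCycle_ne_one {G : Type*} [Group G] {m : ℕ} (hm : 5 ≤ m + 2)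
    (f : alternatingGroup (Fin (m + 2)) →* G) (i : Fin m) (hi : f (starCycle i) ≠ 1) :
    Function.Injective f := by
  have := alternatingGroup.isSimpleGroup (α := Fin (m + 2)) (by simpa using hm)
  rw [← MonoidHom.ker_eq_bot_iff]
  refine (MonoidHom.normal_ker f).eq_bot_or_eq_top.resolve_right fun h => hi ?_
  exact MonoidHom.mem_ker.1 (h ▸ Subgroup.mem_top _)

/-- An element of `GL` of order dividing three. -/
def glOfCube {n R : Type*} [Fintype n] [DecidableEq n] [CommRing R] (A : Matrix n n R)
    (hA : A * (A * A) = 1) : Matrix.GeneralLinearGroup n R where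
  val := A
  inv := A * A
  val_inv := hA
  inv_val := by rw [mul_assoc, hA]

/-- The images in `GL₄(𝔽₂)` of six star three-cycles. -/
def starMatrix : Fin 6 → Matrix (Fin 4) (Fin 4) (ZMod 2) :=
  ![!![0, 1, 0, 0; 1, 1, 0, 0; 0, 0, 0, 1; 0, 0, 1, 1],
    !![1, 1, 0, 0; 1, 0, 0, 0; 1, 0, 1, 1; 1, 1, 1, 0],
    !![0, 0, 1, 0; 1, 1, 1, 1; 1, 0, 1, 0; 1, 1, 0, 0],
    !![1, 0, 1, 0; 0, 0, 1, 1; 1, 0, 0, 0; 1, 1, 1, 1],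
    !![0, 1, 1, 0; 0, 1, 1, 1; 1, 0, 0, 1; 1, 1, 0, 1],
    !![1, 1, 1, 0; 1, 0, 1, 1; 0, 0, 1, 1; 0, 0, 1, 0]]

theorem starMatrix_cube (i : Fin 6) : starMatrix i * (starMatrix i * starMatrix i) = 1 := by
  decide +revert

theorem starMatrix_mul_sq (i j : Fin 6) (hij : i ≠ j) :
    (starMatrix i * starMatrix j) * (starMatrix i * starMatrix j) = 1 := by
  decide +revert

theorem nonempty_mulEquiv_alternatingGroup_eight :
    Nonempty (Matrix.GeneralLinearGroup (Fin 4) (ZMod 2) ≃* alternatingGroup (Fin 8)) := by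
  have hrel : CarmichaelRel fun i => glOfCube (starMatrix i) (starMatrix_cube i) :=
    ⟨fun i => Units.ext (by
        rw [pow_succ', sq]; exact starMatrix_cube i),
      fun i j hij => Units.ext (by rw [sq]; exact starMatrix_mul_sq i j hij)⟩
  obtain ⟨f, hf⟩ := hrel.exists_hom
  have hinj : Function.Injective f := by
    refine injective_of_starCycle_ne_one (by norm_num) f 0 ?_
    rw [hf]
    intro h
    have h0 := congrArg (fun g => g.1 0 0) h
    exact absurd h0 (by decide)
  have hbij : Function.Bijective f := by
    refine (Nat.bijective_iff_injective_and_card _).2 ⟨hinj, ?_⟩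
    -- Both groups have order 20160.
    rw [nat_card_alternatingGroup, Matrix.card_GL_field]
    simp [Fin.prod_univ_succ, Nat.factorial]
  exact ⟨(MulEquiv.ofBijective f hbij).symm⟩

section FourElements

variable {K : Type*} [Field K]

/-- The images in `SL₂(𝔽₄)` of three star three-cycles, for a primitive cube root of unity `w`. -/
def starMatrixFour (w : K) : Fin 3 → Matrix (Fin 2) (Fin 2) K :=
  ![!![0, 1; 1, 1], !![0, w; w + 1, 1], !![0, w + 1; w, 1]]

theorem starMatrixFour_cube {w : K} (h2 : (2 : K) = 0) (hw : w ^ 2 = w + 1) (i : Fin 3) :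
    starMatrixFour w i * (starMatrixFour w i * starMatrixFour w i) = 1 := by
  fin_cases i <;> ext a b <;> fin_cases a <;> fin_cases b <;>
    simp [starMatrixFour, Matrix.mul_apply, Fin.sum_univ_two] <;> grind

theorem starMatrixFour_mul_sq {w : K} (h2 : (2 : K) = 0) (hw : w ^ 2 = w + 1) (i j : Fin 3)
    (hij : i ≠ j) :
    (starMatrixFour w i * starMatrixFour w j) * (starMatrixFour w i * starMatrixFour w j) = 1 := by
  fin_cases i <;> fin_cases j <;> first | exact absurd rfl hij | skip
  all_goals
    ext a b
    fin_cases a <;> fin_cases b <;>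
      simp [starMatrixFour, Matrix.mul_apply, Fin.sum_univ_two] <;> grind

theorem det_starMatrixFour {w : K} (h2 : (2 : K) = 0) (hw : w ^ 2 = w + 1) (i : Fin 3) :
    (starMatrixFour w i).det = 1 := by
  fin_cases i <;> simp [starMatrixFour, Matrix.det_fin_two] <;> grind

theorem exists_sq_eq_add_one (hK : Nat.card K = 4) : (2 : K) = 0 ∧ ∃ w : K, w ^ 2 = w + 1 := by
  have : Finite K := Nat.finite_of_card_ne_zero (by omega)
  have := Fintype.ofFinite K
  have hK' : Fintype.card K = 4 := by rw [← Nat.card_eq_fintype_card, hK]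
  have h4 : (4 : K) = 0 := by
    have := FiniteField.cast_card_eq_zero K
    rw [hK'] at this
    exact_mod_cast this
  have h2 : (2 : K) = 0 := by
    have : (2 : K) * 2 = 0 := by rw [← h4]; norm_num
    simpa using this
  refine ⟨h2, ?_⟩
  classical
  obtain ⟨w, hw⟩ : ∃ w : K, w ∉ ({0, 1} : Finset K) := by
    by_contra! h
    have h1 := Finset.card_le_card (fun x _ => h x : (Finset.univ : Finset K) ⊆ {0, 1})
    have h3 : ({0, 1} : Finset K).card ≤ 2 := Finset.card_le_two
    rw [Finset.card_univ] at h1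
    omega
  simp only [Finset.mem_insert, Finset.mem_singleton, not_or] at hw
  have hp := FiniteField.pow_card w
  rw [hK'] at hp
  -- This is the factorization of w⁴ - w; its quadratic factor gives w² = w + 1 in characteristic 2.
  have h5 : w * (w - 1) * (w ^ 2 + w + 1) = 0 := by linear_combination hp
  have h6 : w ^ 2 + w + 1 = 0 :=
    (mul_eq_zero.1 h5).resolve_left (mul_ne_zero hw.1 (sub_ne_zero.2 hw.2))
  exact ⟨w, by linear_combination h6 - (w + 1) * h2⟩

/-- The alternating group embeds with determinant 1, and C₃ as the scalars. The two meet trivially,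
and the orders agree: 180 = 60 · 3. -/
theorem nonempty_mulEquiv_alternatingGroup_five_prod (hK : Nat.card K = 4) :
    Nonempty (Matrix.GeneralLinearGroup (Fin 2) K ≃*
      alternatingGroup (Fin 5) × Multiplicative (ZMod 3)) := by
  have : Finite K := Nat.finite_of_card_ne_zero (by omega)
  have := Fintype.ofFinite K
  obtain ⟨h2, w, hw⟩ := exists_sq_eq_add_one hK
  have hw0 : w ≠ 0 := by rintro rfl; simp at hw
  have hw1 : w ≠ 1 := by rintro rfl; simp at hw
  have hw3 : w ^ 3 = 1 := by linear_combination (w + 1) * hw + w * h2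
  have hrel : CarmichaelRel fun i => glOfCube (starMatrixFour w i) (starMatrixFour_cube h2 hw i) :=
    ⟨fun i => Units.ext (by
        rw [pow_succ', sq]; exact starMatrixFour_cube h2 hw i),
      fun i j hij => Units.ext (by rw [sq]; exact starMatrixFour_mul_sq h2 hw i j hij)⟩
  obtain ⟨f, hf⟩ := hrel.exists_hom
  have hinj : Function.Injective f := by
    refine injective_of_starCycle_ne_one (by norm_num) f 0 ?_
    rw [hf]
    intro h
    have h0 : (0 : K) = 1 := congrArg (fun g => g.1 0 0) h
    exact zero_ne_one h0
  have hdet : Matrix.GeneralLinearGroup.det.comp f = 1 := by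
    apply MonoidHom.eq_of_eqOn_dense (closure_starCycle 3)
    rintro _ ⟨i, rfl⟩
    apply Units.ext
    simpa [hf, glOfCube] using det_starMatrixFour h2 hw i
  let y : Matrix.GeneralLinearGroup (Fin 2) K :=
    Matrix.GeneralLinearGroup.scalar (Fin 2) (Units.mk0 w hw0)
  have hy3 : y ^ 3 = 1 := by
    rw [← map_pow, show Units.mk0 w hw0 ^ 3 = 1 from Units.ext (by simpa using hw3), map_one]
  obtain ⟨F, hF⟩ := exists_hom_prod_zmod_three f hy3 fun g =>
    (Matrix.GeneralLinearGroup.scalar_commute _ _).symm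
  have hFinj : Function.Injective F := by
    rw [injective_iff_map_eq_one]
    rintro ⟨g, d⟩ h
    obtain ⟨k, hk, rfl⟩ := exists_eq_ofAdd_one_pow d
    rw [hF] at h
    have h3 := congrArg (fun g => ((Matrix.GeneralLinearGroup.det g : Kˣ) : K)) h
    have h4 : Matrix.GeneralLinearGroup.det (f g) = 1 := DFunLike.congr_fun hdet g
    -- A scalar matrix w^k has determinant w^(2k), which for k < 3 is 1 only when k = 0.
    have h5 : (w ^ 2) ^ k = 1 := by
      simpa [h4, y, Matrix.det_smul] using h3
    have hk0 : k = 0 := by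
      interval_cases k
      · rfl
      · exact absurd (by linear_combination h5 - hw) hw0
      · exact absurd (by linear_combination h5 - w * hw3) hw1
    subst hk0
    rw [pow_zero, mul_one] at h
    simp [(injective_iff_map_eq_one f).1 hinj g h]
  have hbij : Function.Bijective F := by
    refine (Nat.bijective_iff_injective_and_card _).2 ⟨hFinj, ?_⟩
    rw [Nat.card_prod, nat_card_alternatingGroup, Matrix.card_GL_field,
      ← Nat.card_eq_fintype_card, hK]
    simp [Fin.prod_univ_succ, Nat.factorial]
  exact ⟨(MulEquiv.ofBijective F hbij).symm⟩

end FourElements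

end Spinorial

namespace Spinorial

/-! ### Elements of a Clifford algebra killed by all contractions -/

section NumberOperator

open CliffordAlgebra

variable {V : Type*} [AddCommGroup V] [Module ℂ V] {ι : Type*} [Fintype ι]

/-- The number operator of the exterior algebra, which multiplies elements of degree `k`
by `k`. -/
noncomputable def numberOp (b : Module.Basis ι ℂ V) :
    ExteriorAlgebra ℂ V →ₗ[ℂ] ExteriorAlgebra ℂ V :=
  ∑ i, LinearMap.mulLeft ℂ (ExteriorAlgebra.ι ℂ (b i)) ∘ₗ
    contractLeft (Q := (0 : QuadraticForm ℂ V)) (b.coord i)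

theorem numberOp_apply (b : Module.Basis ι ℂ V) (x : ExteriorAlgebra ℂ V) :
    numberOp b x = ∑ i, ExteriorAlgebra.ι ℂ (b i) *
      contractLeft (Q := (0 : QuadraticForm ℂ V)) (b.coord i) x := by
  simp [numberOp]

/-- Contraction is an antiderivation, and moving b_i past v cancels its sign; the extra term sums to
v by the basis expansion. -/
theorem numberOp_ι_mul (b : Module.Basis ι ℂ V) (v : V) (x : ExteriorAlgebra ℂ V) :
    numberOp b (ExteriorAlgebra.ι ℂ v * x) =
      ExteriorAlgebra.ι ℂ v * x + ExteriorAlgebra.ι ℂ v * numberOp b x := by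
  have h1 (i : ι) : ExteriorAlgebra.ι ℂ (b i) *
      contractLeft (Q := (0 : QuadraticForm ℂ V)) (b.coord i) (ExteriorAlgebra.ι ℂ v * x) =
      ExteriorAlgebra.ι ℂ (b.repr v i • b i) * x + ExteriorAlgebra.ι ℂ v *
        (ExteriorAlgebra.ι ℂ (b i) *
          contractLeft (Q := (0 : QuadraticForm ℂ V)) (b.coord i) x) := by
    have h2 := contractLeft_ι_mul (Q := (0 : QuadraticForm ℂ V)) (d := b.coord i) v x
    have h3 : ExteriorAlgebra.ι ℂ (b i) * ExteriorAlgebra.ι ℂ v =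
        -(ExteriorAlgebra.ι ℂ v * ExteriorAlgebra.ι ℂ (b i)) :=
      eq_neg_of_add_eq_zero_left (ExteriorAlgebra.ι_add_mul_swap _ _)
    refine (congrArg (ExteriorAlgebra.ι ℂ (b i) * ·) h2).trans ?_
    change ExteriorAlgebra.ι ℂ (b i) * (_ - ExteriorAlgebra.ι ℂ v * _) = _
    rw [mul_sub, ← mul_assoc _ (ExteriorAlgebra.ι ℂ v), h3, map_smul]
    simp [mul_assoc]
  rw [numberOp_apply, numberOp_apply, Finset.sum_congr rfl fun i _ => h1 i,
    Finset.sum_add_distrib, ← Finset.sum_mul, ← map_sum, b.sum_repr, Finset.mul_sum]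

theorem numberOp_of_mem (b : Module.Basis ι ℂ V) {k : ℕ} {x : ExteriorAlgebra ℂ V}
    (hx : x ∈ ⋀[ℂ]^k V) : numberOp b x = (k : ℂ) • x := by
  induction hx using Submodule.pow_induction_on_left' with
  | algebraMap r =>
    rw [numberOp_apply]
    simp [contractLeft_algebraMap]
  | add x y i hx hy h1 h2 => rw [map_add, h1, h2, smul_add]
  | mem_mul m hm i x hx h =>
    obtain ⟨v, rfl⟩ := hm
    rw [numberOp_ι_mul, h]
    simp [add_smul, add_comm]

theorem proj_numberOp (b : Module.Basis ι ℂ V) (k : ℕ) (x : ExteriorAlgebra ℂ V) :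
    GradedRing.proj (fun i : ℕ => ⋀[ℂ]^i V) k (numberOp b x) =
      (k : ℂ) • GradedRing.proj (fun i : ℕ => ⋀[ℂ]^i V) k x := by
  induction x using DirectSum.Decomposition.inductionOn (fun i : ℕ => ⋀[ℂ]^i V) with
  | zero => simp
  | @homogeneous i m =>
    rw [numberOp_of_mem b m.2]
    by_cases h : i = k
    · subst h
      rw [GradedRing.proj_apply, GradedRing.proj_apply,
        DirectSum.decompose_of_mem_same (fun i : ℕ => ⋀[ℂ]^i V) m.2,
        DirectSum.decompose_of_mem_same (fun i : ℕ => ⋀[ℂ]^i V) (Submodule.smul_mem _ _ m.2)]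
    · rw [GradedRing.proj_apply, GradedRing.proj_apply,
        DirectSum.decompose_of_mem_ne (fun i : ℕ => ⋀[ℂ]^i V) m.2 h,
        DirectSum.decompose_of_mem_ne (fun i : ℕ => ⋀[ℂ]^i V) (Submodule.smul_mem _ _ m.2) h, smul_zero]
  | add x y hx hy => simp only [map_add, hx, hy, smul_add]

theorem mem_range_algebraMap_of_numberOp_eq_zero (b : Module.Basis ι ℂ V)
    {x : ExteriorAlgebra ℂ V} (hx : numberOp b x = 0) : ∃ c : ℂ, x = algebraMap ℂ _ c := by
  have hk (k : ℕ) (hk : k ≠ 0) : GradedRing.proj (fun i : ℕ => ⋀[ℂ]^i V) k x = 0 := by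
    have := proj_numberOp b k x
    rw [hx, map_zero] at this
    exact (smul_eq_zero.1 this.symm).resolve_left (Nat.cast_ne_zero.2 hk)
  have h0 : x ∈ ⋀[ℂ]^0 V := by
    classical
    rw [← DirectSum.sum_support_decompose (fun i : ℕ => ⋀[ℂ]^i V) x]
    refine Submodule.sum_mem _ fun i _ => ?_
    by_cases hi : i = 0
    · subst hi
      exact SetLike.coe_mem _
    · have := hk i hi
      rw [GradedRing.proj_apply] at this
      rw [this]
      exact zero_mem _
  change x ∈ LinearMap.range (ExteriorAlgebra.ι ℂ) ^ 0 at h0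
  rw [pow_zero, Submodule.mem_one] at h0
  obtain ⟨c, hc⟩ := h0
  exact ⟨c, hc.symm⟩

/-- The change of form to the exterior algebra commutes with contractions. There the number operator
kills the element, so in characteristic zero only its degree 0 part survives. -/
theorem exists_eq_algebraMap_of_contractLeft_eq_zero [FiniteDimensional ℂ V]
    {Q : QuadraticForm ℂ V} {x : CliffordAlgebra Q} (hx : ∀ d, contractLeft d x = 0) :
    ∃ c : ℂ, x = algebraMap ℂ _ c := by
  have h := changeForm.associated_neg_proof (Q := Q)
  obtain ⟨c, hc⟩ := mem_range_algebraMap_of_numberOp_eq_zero (Module.finBasis ℂ V)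
    (x := changeForm h x) (by
      rw [numberOp_apply]
      refine Finset.sum_eq_zero fun i _ => ?_
      have := changeForm_contractLeft h ((Module.finBasis ℂ V).coord i) x
      rw [hx, map_zero] at this
      rw [← this, mul_zero])
  refine ⟨c, (changeFormEquiv h).injective ?_⟩
  exact hc.trans (changeForm_algebraMap h c).symm

end NumberOperator

/-! ### Kernel and surjectivity of the Pin cover -/

section Pin

variable {V : Type*} [AddCommGroup V] [Module ℂ V] {Φ : LinearMap.BilinForm ℂ V}

theorem incl_mul_incl_add_swap (hΦ : Φ.IsSymm) (v w : V) :
    incl Φ v * incl Φ w + incl Φ w * incl Φ v = algebraMap ℂ (Cliff Φ) (-(2 * Φ v w)) := by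
  have h : Φ w v = Φ v w := hΦ.eq w v
  rw [CliffordAlgebra.ι_mul_ι_add_swap]
  congr 1
  simp only [QuadraticMap.polar, negForm, neg_apply,
    LinearMap.BilinMap.toQuadraticMap_apply, map_add, LinearMap.add_apply, h]
  ring

/-- The twisted commutator with w is an antiderivation, determined by its values on vectors. It
turns the triviality of the twisted conjugation by x into the vanishing of contractions of x. -/
theorem incl_mul_sub_involute_mul (hΦ : Φ.IsSymm) (w : V) (x : Cliff Φ) :
    incl Φ w * x - CliffordAlgebra.involute x * incl Φ w =
      CliffordAlgebra.contractLeft ((-2 : ℂ) • Φ w) x := by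
  induction x using CliffordAlgebra.left_induction with
  | algebraMap r => simp [Algebra.commutes r]
  | add x y hx hy =>
    rw [map_add, map_add, ← hx, ← hy]
    noncomm_ring
  | ι_mul x v hx =>
    rw [CliffordAlgebra.contractLeft_ι_mul, ← hx, map_mul, CliffordAlgebra.involute_ι]
    have h := incl_mul_incl_add_swap hΦ w v
    have h2 : incl Φ w * incl Φ v = algebraMap ℂ (Cliff Φ) (-(2 * Φ w v)) -
      incl Φ v * incl Φ w := eq_sub_of_add_eq h
    rw [← mul_assoc, h2, Algebra.smul_def]
    simp only [LinearMap.smul_apply, smul_eq_mul, neg_mul, sub_mul, mul_sub, mul_assoc]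
    abel

/-- A unit vector u has inverse -u, which is what reversal and the grading involution make of it.
Both fix scalars, so a scalar in Pin squares to 1. -/
theorem mul_reverse_involute (x : (Cliff Φ)ˣ) (hx : x ∈ Pin Φ) :
    (x : Cliff Φ) * CliffordAlgebra.reverse (CliffordAlgebra.involute (x : Cliff Φ)) = 1 := by
  induction hx using Subgroup.closure_induction with
  | mem x hx =>
    obtain ⟨u, hu, h⟩ := hx
    rw [h]
    simp [hu]
  | one => simp
  | mul x y _ _ hx hy =>
    rw [Units.val_mul, map_mul, CliffordAlgebra.reverse.map_mul, mul_assoc, ← mul_assoc (y : Cliff Φ),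
      hy, one_mul, hx]
  | inv x _ hx =>
    have h1 := (Units.inv_eq_of_mul_eq_one_right hx).symm
    have h2 : CliffordAlgebra.reverse (CliffordAlgebra.involute
        (((x⁻¹ : (Cliff Φ)ˣ) : Cliff Φ) * (x : Cliff Φ))) = 1 := by simp
    rw [map_mul, CliffordAlgebra.reverse.map_mul, h1] at h2
    exact h2

theorem reflection_mem_range (hΦ : Φ.IsSymm) (u : V) (hu : Φ u u = 1) :
    (⟨reflection Φ u hu, reflection_mem Φ hΦ u hu⟩ : orthogonalGroup Φ) ∈
      (pinCover Φ hΦ).range :=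
  ⟨_, Subtype.ext (pinCover_unitVector Φ hΦ u hu)⟩

/-- Any unit vector is moved to any other one by at most two reflections. -/
theorem exists_mem_range_pinCover_apply_eq (hΦ : Φ.IsSymm) {a v : V} (ha : Φ a a = 1)
    (hv : Φ v v = 1) :
    ∃ r ∈ (pinCover Φ hΦ).range, r.1 a = v ∧ ∀ w, Φ w a = 0 → Φ w v = 0 → r.1 w = w := by
  have hva : Φ v a = Φ a v := hΦ.eq v a
  by_cases h : Φ a v = 1
  -- Here a - v is isotropic and defines no reflection. Reflecting in (a + v)/2 sends a to -v, and
  -- reflecting in v then gives v.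
  · have hu : Φ ((2 : ℂ)⁻¹ • (a + v)) ((2 : ℂ)⁻¹ • (a + v)) = 1 := by
      simp only [map_smul, LinearMap.smul_apply, map_add, LinearMap.add_apply, smul_eq_mul, ha, hv,
        hva, h]
      norm_num
    refine ⟨_, mul_mem (reflection_mem_range hΦ v hv) (reflection_mem_range hΦ _ hu), ?_, ?_⟩
    · have h1 : reflection Φ _ hu a = -v := by
        rw [reflection_apply]
        simp only [map_smul, LinearMap.smul_apply, map_add, LinearMap.add_apply, smul_eq_mul, ha,
          hva, h, smul_smul]
        norm_num
      simp only [Subgroup.coe_mul, LinearEquiv.mul_apply, h1]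
      rw [reflection_apply, map_neg, hv]
      module
    · intro w hwa hwv
      have haw : Φ a w = 0 := by rw [← hwa]; exact hΦ.eq a w
      have hvw : Φ v w = 0 := by rw [← hwv]; exact hΦ.eq v w
      simp [reflection_apply, haw, hvw]
  -- The scalar s normalizes a - v, whose norm is 2 - 2Φ(a, v); the reflection in it exchanges a and
  -- v.
  · obtain ⟨s, hs⟩ : ∃ s : ℂ, s ^ 2 = 2 - 2 * Φ a v := IsAlgClosed.exists_pow_nat_eq _ (by norm_num)
    have hs2 : s ^ 2 ≠ 0 := by
      rw [hs]
      intro h0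
      exact h (by linear_combination -h0 / 2)
    have hs0 : s ≠ 0 := fun h => hs2 (by rw [h]; norm_num)
    have hu : Φ (s⁻¹ • (a - v)) (s⁻¹ • (a - v)) = 1 := by
      simp only [map_smul, LinearMap.smul_apply, map_sub, LinearMap.sub_apply, smul_eq_mul, ha, hv,
        hva]
      field_simp
      rw [hs]
      ring
    refine ⟨_, reflection_mem_range hΦ _ hu, ?_, ?_⟩
    · change reflection Φ _ hu a = v
      rw [reflection_apply]
      simp only [map_smul, LinearMap.smul_apply, map_sub, LinearMap.sub_apply, smul_eq_mul, ha,
        hva, smul_smul]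
      have : 2 * (s⁻¹ * (1 - Φ a v)) * s⁻¹ = 1 := by
        field_simp
        rw [hs]
        ring
      rw [this, one_smul, sub_sub_cancel]
    · intro w hwa hwv
      have haw : Φ a w = 0 := by rw [← hwa]; exact hΦ.eq a w
      have hvw : Φ v w = 0 := by rw [← hwv]; exact hΦ.eq v w
      simp [reflection_apply, haw, hvw]

variable [FiniteDimensional ℂ V]

theorem exists_eq_algebraMap_of_pinCover_eq_one (hΦ : Φ.IsSymm) (hnd : Φ.Nondegenerate)
    {x : Pin Φ} (hx : pinCover Φ hΦ x = 1) :
    ∃ c : ℂ, ((x : (Cliff Φ)ˣ) : Cliff Φ) = algebraMap ℂ _ c := by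
  apply exists_eq_algebraMap_of_contractLeft_eq_zero
  intro d
  obtain ⟨w, hw⟩ := (Φ.toDual hnd).surjective ((-2 : ℂ)⁻¹ • d)
  have hd : d = (-2 : ℂ) • Φ w := by
    have : Φ w = (-2 : ℂ)⁻¹ • d := hw
    rw [this, smul_smul]
    norm_num
  have h := incl_pinCover Φ hΦ x w
  rw [hx] at h
  change incl Φ w = _ at h
  rw [hd, ← incl_mul_sub_involute_mul hΦ, sub_eq_zero]
  nth_rw 1 [h]
  rw [mul_assoc, Units.inv_mul, mul_one]

theorem sq_eq_one_of_pinCover_eq_one (hΦ : Φ.IsSymm) (hnd : Φ.Nondegenerate)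
    (x : Pin Φ) (hx : pinCover Φ hΦ x = 1) : x ^ 2 = 1 := by
  obtain ⟨c, hc⟩ := exists_eq_algebraMap_of_pinCover_eq_one hΦ hnd hx
  have h := mul_reverse_involute x.1 x.2
  apply Subtype.ext
  apply Units.ext
  rw [hc, AlgHom.commutes, CliffordAlgebra.reverse.commutes] at h
  rw [Subgroup.coe_pow, Units.val_pow_eq_pow_val, hc, sq, h]
  rfl

theorem commute_of_pinCover_eq_one (hΦ : Φ.IsSymm) (hnd : Φ.Nondegenerate)
    (x : Pin Φ) (hx : pinCover Φ hΦ x = 1) (y : Pin Φ) : Commute x y := by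
  obtain ⟨c, hc⟩ := exists_eq_algebraMap_of_pinCover_eq_one hΦ hnd hx
  apply Subtype.ext
  apply Units.ext
  rw [Subgroup.coe_mul, Subgroup.coe_mul, Units.val_mul, Units.val_mul, hc, Algebra.commutes]

theorem exists_orthonormal_basis (hΦ : Φ.IsSymm) (hnd : Φ.Nondegenerate) :
    ∃ b : Module.Basis (Fin (Module.finrank ℂ V)) ℂ V,
      ∀ i j, Φ (b i) (b j) = if i = j then 1 else 0 := by
  obtain ⟨b, hb⟩ := LinearMap.BilinForm.exists_orthogonal_basis
    (LinearMap.BilinForm.isSymm_iff.1 hΦ)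
  have hne := hb.not_isOrtho_basis_self_of_separatingLeft hnd.1
  have hs (i) : ∃ s : ℂ, s ^ 2 = Φ (b i) (b i) := IsAlgClosed.exists_pow_nat_eq _ (by norm_num)
  choose s hs using hs
  have hs0 (i) : s i ≠ 0 := fun h => hne i (by rw [← hs, h]; norm_num)
  refine ⟨b.unitsSMul fun i => (Units.mk0 (s i) (hs0 i))⁻¹, fun i j => ?_⟩
  simp only [Module.Basis.unitsSMul_apply, Units.smul_def, map_smul, LinearMap.smul_apply,
    smul_eq_mul, Units.val_inv_eq_inv_val, Units.val_mk0]
  split_ifs with h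
  · subst h
    rw [← hs]
    field_simp [hs0 i]
  · rw [show Φ (b i) (b j) = 0 from hb h]
    simp

/-- In the manner of Cartan and Dieudonné, reflections restore the vectors of an orthonormal basis
one at a time, until the product is the identity. -/
theorem pinCover_surjective (hΦ : Φ.IsSymm) (hnd : Φ.Nondegenerate) :
    Function.Surjective (pinCover Φ hΦ) := by
  obtain ⟨b, hb⟩ := exists_orthonormal_basis hΦ hnd
  intro g
  have key (k : ℕ) : ∃ r ∈ (pinCover Φ hΦ).range,
      ∀ i : Fin (Module.finrank ℂ V), i.val < k → (r * g).1 (b i) = b i := by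
    induction k with
    | zero => exact ⟨1, one_mem _, fun i hi => absurd hi (by omega)⟩
    | succ k ih =>
      obtain ⟨r, hr, hfix⟩ := ih
      by_cases hk : k < Module.finrank ℂ V
      · have hbk : Φ (b ⟨k, hk⟩) (b ⟨k, hk⟩) = 1 := by simp [hb]
        -- The vectors already restored are orthogonal to b_k and to its current image, so t fixes
        -- them.
        obtain ⟨t, ht, h1, h2⟩ := exists_mem_range_pinCover_apply_eq hΦ
          (((r * g).2 _ _).trans hbk) hbk
        refine ⟨t * r, mul_mem ht hr, fun i hi => ?_⟩
        rw [mul_assoc, Subgroup.coe_mul, LinearEquiv.mul_apply]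
        rcases Nat.lt_succ_iff_lt_or_eq.1 hi with hi | rfl
        · have hi0 : Φ (b i) (b ⟨k, hk⟩) = 0 := by
            rw [hb, if_neg]
            rintro rfl
            exact lt_irrefl _ hi
          rw [hfix i hi]
          refine h2 _ ?_ hi0
          have h3 := (r * g).2 (b i) (b ⟨k, hk⟩)
          rwa [hfix i hi, hi0] at h3
        · exact h1
      · exact ⟨r, hr, fun i hi => hfix i (by omega)⟩
  obtain ⟨r, hr, hfix⟩ := key (Module.finrank ℂ V)
  have h1 : r * g = 1 := by
    apply Subtype.ext
    apply LinearEquiv.toLinearMap_injective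
    exact b.ext fun i => hfix i i.2
  rw [eq_inv_of_mul_eq_one_right h1]
  exact inv_mem hr

end Pin

/-! ### Squares of lifts of involutions -/

section Involution

variable {V : Type*} [AddCommGroup V] [Module ℂ V] {Φ : LinearMap.BilinForm ℂ V}

theorem det_reflection [FiniteDimensional ℂ V] (u : V) (hu : Φ u u = 1) :
    LinearMap.det (reflection Φ u hu : V →ₗ[ℂ] V) = -1 := by
  have h : (reflection Φ u hu : V →ₗ[ℂ] V) = LinearMap.transvection (-(2 : ℂ) • Φ u) u := by
    ext v
    simp [reflection_apply, LinearMap.transvection.apply, sub_eq_add_neg]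
  rw [h, LinearMap.transvection.det]
  simp only [LinearMap.smul_apply, hu, smul_eq_mul]
  norm_num

/-- The product of pairwise orthogonal unit vectors, as an element of `Pin(V)`. -/
theorem exists_pin_list_prod [FiniteDimensional ℂ V] (hΦ : Φ.IsSymm) (l : List V)
    (h1 : ∀ u ∈ l, Φ u u = 1) (h2 : l.Pairwise fun u v => Φ u v = 0) :
    ∃ x : Pin Φ,
      (∀ v, (pinCover Φ hΦ x).1 v = v - (2 : ℂ) • (l.map fun u => Φ u v • u).sum) ∧
      LinearMap.det ((pinCover Φ hΦ x).1 : V →ₗ[ℂ] V) = (-1) ^ l.length ∧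
      (∀ w, (∀ u ∈ l, Φ w u = 0) →
        (x.1 : Cliff Φ) * incl Φ w = (-1) ^ l.length * (incl Φ w * (x.1 : Cliff Φ))) ∧
      (x.1 : Cliff Φ) ^ 2 = (-1) ^ (l.length * (l.length + 1) / 2) := by
  induction l with
  | nil =>
    refine ⟨1, fun v => ?_, ?_, fun w _ => ?_, ?_⟩
    · simp
    · rw [map_one]
      exact LinearMap.det_id
    · simp
    · simp
  | cons u l ih =>
    obtain ⟨hu, h1⟩ := List.forall_mem_cons.1 h1
    obtain ⟨hul, h2⟩ := List.pairwise_cons.1 h2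
    obtain ⟨x, hx1, hx2, hx3, hx4⟩ := ih h1 h2
    have huu : incl Φ u * incl Φ u = -1 := by simp [hu]
    have hcov : (pinCover Φ hΦ (⟨unitVector Φ u hu, unitVector_mem Φ u hu⟩ * x)).1 =
        reflection Φ u hu * (pinCover Φ hΦ x).1 := by
      rw [map_mul, Subgroup.coe_mul, pinCover_unitVector]
    have hval : ((⟨unitVector Φ u hu, unitVector_mem Φ u hu⟩ * x : Pin Φ).1 : Cliff Φ) =
        incl Φ u * (x.1 : Cliff Φ) := rfl
    refine ⟨⟨unitVector Φ u hu, unitVector_mem Φ u hu⟩ * x, fun v => ?_, ?_, fun w hw => ?_, ?_⟩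
    · have h0 : Φ u (l.map fun e => Φ e v • e).sum = 0 := by
        rw [map_list_sum, List.map_map]
        refine List.sum_eq_zero fun a ha => ?_
        obtain ⟨e, he, rfl⟩ := List.mem_map.1 ha
        simp [hul e he]
      rw [hcov, LinearEquiv.mul_apply, hx1, reflection_apply, map_sub, map_smul, h0]
      simp only [List.map_cons, List.sum_cons]
      module
    · rw [hcov]
      have : ((reflection Φ u hu * (pinCover Φ hΦ x).1 : V ≃ₗ[ℂ] V) : V →ₗ[ℂ] V) =
        (reflection Φ u hu : V →ₗ[ℂ] V) * ((pinCover Φ hΦ x).1 : V →ₗ[ℂ] V) := rfl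
      rw [this, map_mul, det_reflection, hx2, List.length_cons, pow_succ']
    · obtain ⟨hwu, hw⟩ := List.forall_mem_cons.1 hw
      have hanti : incl Φ u * incl Φ w = -(incl Φ w * incl Φ u) := by
        have h := incl_mul_incl_add_swap hΦ u w
        rw [show Φ u w = 0 by rw [← hwu]; exact hΦ.eq u w] at h
        exact eq_neg_of_add_eq_zero_left (by simpa using h)
      rw [hval, mul_assoc, hx3 w hw, List.length_cons]
      rcases neg_one_pow_eq_or (Cliff Φ) l.length with h | h <;>
        rw [pow_succ, h] <;>
        simp only [one_mul, neg_mul, mul_neg, neg_neg, ← mul_assoc, hanti]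
    · have h3 := hx3 u hul
      -- Moving u past the l remaining factors gives (-1)^l, and u² = -1 gives one more sign; the
      -- exponents add up to a triangular number.
      have h4 : (incl Φ u * (x.1 : Cliff Φ)) ^ 2 =
          (-1) ^ (l.length + 1) * (x.1 : Cliff Φ) ^ 2 := by
        calc (incl Φ u * (x.1 : Cliff Φ)) ^ 2
            = incl Φ u * ((x.1 : Cliff Φ) * incl Φ u) * (x.1 : Cliff Φ) := by
              simp only [sq, mul_assoc]
          _ = (-1) ^ (l.length + 1) * (x.1 : Cliff Φ) ^ 2 := by
              rw [h3]
              rcases neg_one_pow_eq_or (Cliff Φ) l.length with h | h <;>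
                rw [pow_succ, h] <;>
                simp only [one_mul, neg_mul, mul_neg, neg_neg, ← mul_assoc, huu, sq]
      rw [hval, h4, hx4, ← pow_add, List.length_cons]
      congr 1
      rw [show (l.length + 1) * (l.length + 1 + 1) =
        l.length * (l.length + 1) + (l.length + 1) * 2 by ring,
        Nat.add_mul_div_right _ _ (by norm_num), add_comm]

/-- The lift to `Pin(V)` of an orthogonal involution, whose eigenvalue `-1` has multiplicity `m`. -/
theorem exists_pin_of_involution [FiniteDimensional ℂ V] (hΦ : Φ.IsSymm) (hnd : Φ.Nondegenerate)
    (s : orthogonalGroup Φ) (hs : s ^ 2 = 1) :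
    ∃ (x : Pin Φ) (m : ℕ), pinCover Φ hΦ x = s ∧
      (x.1 : Cliff Φ) ^ 2 = (-1) ^ (m * (m + 1) / 2) ∧
      LinearMap.det (s.1 : V →ₗ[ℂ] V) = (-1) ^ m ∧
      (Module.finrank ℂ V : ℂ) - LinearMap.trace ℂ V (s.1 : V →ₗ[ℂ] V) = 2 * m := by
  have hss (v : V) : s.1 (s.1 v) = v := by
    have h : (s ^ 2).1 v = v := by rw [hs]; rfl
    rwa [sq] at h
  -- The projection onto the (-1)-eigenspace W, so that s = 1 - 2p; its trace is dim W.
  let p : V →ₗ[ℂ] V := (2 : ℂ)⁻¹ • (LinearMap.id - (s.1 : V →ₗ[ℂ] V))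
  have hp (v : V) : p v = (2 : ℂ)⁻¹ • (v - s.1 v) := rfl
  let W : Submodule ℂ V := LinearMap.ker (LinearMap.id + (s.1 : V →ₗ[ℂ] V))
  have hW {v : V} : v ∈ W ↔ s.1 v = -v := by
    rw [LinearMap.mem_ker, eq_neg_iff_add_eq_zero, add_comm]
    rfl
  have hpW (v : V) : p v ∈ W := by
    rw [hW, hp, map_smul, map_sub, hss]
    module
  have hpid (v : V) (hv : v ∈ W) : p v = v := by
    rw [hp, hW.1 hv]
    module
  have hproj : LinearMap.IsProj W p := ⟨hpW, hpid⟩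
  have hortho (w : V) (hw : w ∈ W) (v : V) : Φ w (p v) = Φ w v := by
    have h1 := s.2 w v
    rw [hW.1 hw, map_neg, LinearMap.neg_apply] at h1
    rw [hp, map_smul, map_sub, smul_eq_mul]
    linear_combination (1 / 2 : ℂ) * h1
  -- A vector of W pairs with v as it does with p v, so one orthogonal to W is orthogonal to all of
  -- V.
  have hndW : (Φ.restrict W).Nondegenerate := by
    have hl : (Φ.restrict W).SeparatingLeft := by
      intro w hw
      apply Subtype.ext
      apply hnd.1
      intro v
      rw [← hortho w w.2 v]
      exact hw ⟨p v, hpW v⟩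
    refine ⟨hl, fun w hw => hl w fun y => ?_⟩
    rw [(hΦ.restrict W).eq]
    exact hw y
  obtain ⟨b, hb⟩ := exists_orthonormal_basis (hΦ.restrict W) hndW
  have hb' (i j) : Φ (b i) (b j) = if i = j then 1 else 0 := hb i j
  obtain ⟨x, hx1, hx2, -, hx4⟩ := exists_pin_list_prod hΦ (List.ofFn fun i => (b i : V))
    (by
      intro u hu
      obtain ⟨i, rfl⟩ := (List.mem_ofFn' _ _).1 hu
      simp [hb'])
    (by
      rw [List.pairwise_ofFn]
      intro i j hij
      rw [hb', if_neg hij.ne])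
  rw [List.length_ofFn] at hx2 hx4
  have hxs : pinCover Φ hΦ x = s := by
    apply Subtype.ext
    apply LinearEquiv.ext
    intro v
    have hsum : (List.map (fun u => Φ u v • u) (List.ofFn fun i => (b i : V))).sum = p v := by
      rw [List.map_ofFn, List.sum_ofFn]
      have h1 : (⟨p v, hpW v⟩ : W) = ∑ i, Φ (b i) v • b i := by
        rw [← b.sum_repr ⟨p v, hpW v⟩]
        refine Finset.sum_congr rfl fun i _ => ?_
        congr 1
        rw [← hortho (b i) (b i).2]
        have h2 : p v = ∑ j, b.repr ⟨p v, hpW v⟩ j • (b j : V) := by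
          have := congrArg W.subtype (b.sum_repr ⟨p v, hpW v⟩)
          rw [map_sum] at this
          exact this.symm
        nth_rw 2 [h2]
        simp [hb']
      have := congrArg Subtype.val h1
      simpa using this.symm
    rw [hx1, hsum, hp]
    module
  refine ⟨x, Module.finrank ℂ W, hxs, hx4, by rw [← hxs, hx2], ?_⟩
  have htr := hproj.trace
  rw [map_smul, map_sub, LinearMap.trace_id, smul_eq_mul] at htr
  rw [← htr]
  ring

end Involution

/-! ### The character criterion -/

section Criterion

variable {V : Type*} [AddCommGroup V] [Module ℂ V] {Φ : LinearMap.BilinForm ℂ V}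
  {G : Type*} [Group G]

/-- A representation that preserves `Φ`, as a homomorphism to the orthogonal group. -/
def Preserves.toOrthogonal {π : Representation ℂ G V} (hπ : Preserves Φ π) :
    G →* orthogonalGroup Φ where
  toFun g := ⟨LinearEquiv.ofLinearMap (π g) (π g⁻¹)
    (by rw [← Module.End.mul_eq_comp, ← map_mul, mul_inv_cancel, map_one]; rfl)
    (by rw [← Module.End.mul_eq_comp, ← map_mul, inv_mul_cancel, map_one]; rfl), hπ g⟩
  map_one' := by
    apply Subtype.ext
    apply LinearEquiv.ext
    intro v
    simp
  map_mul' g h := by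
    apply Subtype.ext
    apply LinearEquiv.ext
    intro v
    simp

theorem Preserves.coe_toOrthogonal {π : Representation ℂ G V} (hπ : Preserves Φ π) (g : G) :
    ((hπ.toOrthogonal g).1 : V →ₗ[ℂ] V) = π g := rfl

theorem isSpinorial_iff_exists_comp {π : Representation ℂ G V} (hΦ : Φ.IsSymm)
    (hπ : Preserves Φ π) :
    IsSpinorial Φ hΦ π ↔ ∃ π' : G →* Pin Φ, (pinCover Φ hΦ).comp π' = hπ.toOrthogonal := by
  refine exists_congr fun π' => ⟨fun h => ?_, fun h g v => ?_⟩
  · apply MonoidHom.ext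
    intro g
    apply Subtype.ext
    apply LinearEquiv.ext
    exact h g
  · change ((pinCover Φ hΦ).comp π' g).1 v = _
    rw [h]
    rfl

/-- If an orthogonal representation lifts as soon as the involution `t` lifts to an involution,
then spinoriality is decided by the character at `t`. -/
theorem isSpinorial_iff_character [FiniteDimensional ℂ V] {π : Representation ℂ G V}
    (hΦ : Φ.IsSymm) (hnd : Φ.Nondegenerate) (hπ : Preserves Φ π) {a b : G} (ha : a ^ 3 = 1)
    (hb : b ^ 3 = 1) (hab : (a * b) ^ 2 = 1)
    (hlift : ∀ s, pinCover Φ hΦ s = hπ.toOrthogonal (a * b) → s ^ 2 = 1 →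
      ∃ π' : G →* Pin Φ, (pinCover Φ hΦ).comp π' = hπ.toOrthogonal) :
    IsSpinorial Φ hΦ π ↔ ∃ k : ℤ, π.character 1 - π.character (a * b) = 8 * (k : ℂ) := by
  rw [isSpinorial_iff_exists_comp hΦ hπ]
  obtain ⟨x, m, hx, hx2, hdet, htr⟩ := exists_pin_of_involution hΦ hnd (hπ.toOrthogonal (a * b))
    (by rw [← map_pow, hab, map_one])
  rw [hπ.coe_toOrthogonal] at hdet htr
  have hchar : π.character 1 - π.character (a * b) = 2 * m := by
    rw [Representation.char_one]
    exact htr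
  -- The determinant at ab has square 1, and cube 1 because a and b have cube 1. Hence m is even.
  have hdet1 : LinearMap.det (π (a * b)) = 1 := by
    have h2 : LinearMap.det (π (a * b)) ^ 2 = 1 := by
      rw [← map_pow, ← map_pow, hab, map_one, map_one]
    have h3 : LinearMap.det (π (a * b)) ^ 3 = 1 := by
      rw [map_mul, map_mul, mul_pow, ← map_pow, ← map_pow, ← map_pow, ← map_pow, ha, hb, map_one,
        map_one, mul_one]
    rw [pow_succ, h2, one_mul] at h3
    exact h3
  have hm : Even m := by
    rw [hdet1] at hdet
    exact (neg_one_pow_eq_one_iff_even (by norm_num)).1 hdet.symm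
  obtain ⟨n, rfl⟩ := hm
  have hexp : (n + n) * (n + n + 1) / 2 = n * (2 * n + 1) := by
    rw [show (n + n) * (n + n + 1) = n * (2 * n + 1) * 2 by ring]
    exact Nat.mul_div_cancel _ (by norm_num)
  rw [hexp] at hx2
  have hne : (-1 : Cliff Φ) ≠ 1 := by
    intro h
    have h2 : algebraMap ℂ (Cliff Φ) (-1) = algebraMap ℂ (Cliff Φ) 1 := by simpa using h
    have := (algebraMap ℂ (Cliff Φ)).injective h2
    norm_num at this
  -- With m = 2n the sign exponent is n(2n + 1), of the same parity as n.
  have hiff : x ^ 2 = 1 ↔ Even n := by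
    rw [← neg_one_pow_eq_one_iff_even hne, Subtype.ext_iff, Units.ext_iff]
    change (x.1 : Cliff Φ) ^ 2 = 1 ↔ _
    rw [hx2, neg_one_pow_eq_one_iff_even hne, neg_one_pow_eq_one_iff_even hne, Nat.even_mul]
    simp
  have hk : (∃ k : ℤ, π.character 1 - π.character (a * b) = 8 * (k : ℂ)) ↔ Even n := by
    rw [hchar]
    constructor
    · rintro ⟨k, hk⟩
      have h1 : (2 * (n + n) : ℤ) = 8 * k := by
        have : ((2 * (n + n) : ℤ) : ℂ) = ((8 * k : ℤ) : ℂ) := by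
          push_cast
          rw [← hk]
          push_cast
          rfl
        exact_mod_cast this
      have h2 : Even (n : ℤ) := ⟨k, by omega⟩
      exact_mod_cast h2
    · rintro ⟨k, rfl⟩
      exact ⟨k, by push_cast; ring⟩
  rw [hk, ← hiff]
  constructor
  · rintro ⟨π', h'⟩
    have h1 : pinCover Φ hΦ (π' (a * b)) = hπ.toOrthogonal (a * b) := DFunLike.congr_fun h' (a * b)
    -- Two lifts of the same element differ by a central element of square 1, so their squares
    -- agree.
    have h2 : pinCover Φ hΦ (x * (π' (a * b))⁻¹) = 1 := by
      rw [map_mul, map_inv, h1, hx, mul_inv_cancel]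
    have h3 : x = x * (π' (a * b))⁻¹ * π' (a * b) := by group
    rw [h3, (commute_of_pinCover_eq_one hΦ hnd _ h2 _).mul_pow,
      sq_eq_one_of_pinCover_eq_one hΦ hnd _ h2, one_mul, ← map_pow, hab, map_one]
  · exact hlift x hx

end Criterion

/-- Conjugating a product of two distinct star cycles supplies the factors of cube 1 that the
determinant argument needs. -/
theorem exists_mul_eq_doubleTransposition {m : ℕ} (hm : 4 ≤ m + 2) :
    ∃ a b : alternatingGroup (Fin (m + 2)), a ^ 3 = 1 ∧ b ^ 3 = 1 ∧ (a * b) ^ 2 = 1 ∧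
      a * b = doubleTransposition (m + 2) hm := by
  have hij : (⟨0, by omega⟩ : Fin m) ≠ ⟨1, by omega⟩ := by simp
  obtain ⟨c, hc⟩ := isConj_iff.1 (isConj_doubleTransposition hm hij).symm
  have hrel := carmichaelRel_starCycle m
  have h : c * starCycle ⟨0, by omega⟩ * c⁻¹ * (c * starCycle ⟨1, by omega⟩ * c⁻¹) =
      doubleTransposition (m + 2) hm := by
    rw [← hc]
    group
  refine ⟨_, _, ?_, ?_, ?_, h⟩
  · rw [conj_pow, hrel.1, mul_one, mul_inv_cancel]
  · rw [conj_pow, hrel.1, mul_one, mul_inv_cancel]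
  · rw [h, ← hc, conj_pow, hrel.2 _ _ hij, mul_one, mul_inv_cancel]

section

variable {V : Type*} [AddCommGroup V] [Module ℂ V] [FiniteDimensional ℂ V]
  {Φ : LinearMap.BilinForm ℂ V} {G : Type*} [Group G] {π : Representation ℂ G V} {m : ℕ}

theorem isSpinorial_iff_of_mulEquiv_alternatingGroup (hm : 4 ≤ m + 2)
    (e : G ≃* alternatingGroup (Fin (m + 2))) (hΦ : Φ.IsSymm) (hnd : Φ.Nondegenerate)
    (hπ : Preserves Φ π) :
    IsSpinorial Φ hΦ π ↔ ∃ k : ℤ,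
      π.character 1 - π.character (e.symm (doubleTransposition (m + 2) hm)) = 8 * (k : ℂ) := by
  obtain ⟨a, b, ha, hb, hab, hd⟩ := exists_mul_eq_doubleTransposition hm
  rw [← hd, map_mul]
  refine isSpinorial_iff_character hΦ hnd hπ (by rw [← map_pow, ha, map_one])
    (by rw [← map_pow, hb, map_one]) (by rw [← map_mul, ← map_pow, hab, map_one]) fun s hs hs2 => ?_
  obtain ⟨π', h'⟩ := exists_lift_alternatingGroup (pinCover_surjective hΦ hnd)
    (sq_eq_one_of_pinCover_eq_one hΦ hnd) (commute_of_pinCover_eq_one hΦ hnd) hm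
    (hπ.toOrthogonal.comp e.symm.toMonoidHom) (s := s) (by rw [hs, ← map_mul, hd]; rfl) hs2
  refine ⟨π'.comp e.toMonoidHom, ?_⟩
  rw [← MonoidHom.comp_assoc, h']
  ext g : 1
  simp

theorem isSpinorial_iff_of_mulEquiv_alternatingGroup_prod (hm : 4 ≤ m + 2)
    (e : G ≃* alternatingGroup (Fin (m + 2)) × Multiplicative (ZMod 3)) (hΦ : Φ.IsSymm)
    (hnd : Φ.Nondegenerate) (hπ : Preserves Φ π) :
    IsSpinorial Φ hΦ π ↔ ∃ k : ℤ,
      π.character 1 - π.character (e.symm (doubleTransposition (m + 2) hm, 1)) = 8 * (k : ℂ) := by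
  obtain ⟨a, b, ha, hb, hab, hd⟩ := exists_mul_eq_doubleTransposition hm
  let f : alternatingGroup (Fin (m + 2)) →* G := e.symm.toMonoidHom.comp (MonoidHom.inl _ _)
  have hf : e.symm (doubleTransposition (m + 2) hm, 1) = f a * f b := by
    rw [← map_mul, hd]
    rfl
  rw [hf]
  refine isSpinorial_iff_character hΦ hnd hπ (by rw [← map_pow, ha, map_one])
    (by rw [← map_pow, hb, map_one]) (by rw [← map_mul, ← map_pow, hab, map_one]) fun s hs hs2 => ?_
  have hsurj := pinCover_surjective hΦ hnd
  have hk := sq_eq_one_of_pinCover_eq_one hΦ hnd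
  have hc := commute_of_pinCover_eq_one hΦ hnd
  obtain ⟨φ, hφ⟩ := exists_lift_alternatingGroup hsurj hk hc hm (hπ.toOrthogonal.comp f) (s := s)
    (by rw [hs, ← map_mul, hd]; rfl) hs2
  obtain ⟨π', h'⟩ := exists_lift_prod_zmod_three hsurj hk hc
    (hπ.toOrthogonal.comp e.symm.toMonoidHom) φ hφ
  refine ⟨π'.comp e.toMonoidHom, ?_⟩
  rw [← MonoidHom.comp_assoc, h']
  ext g : 1
  simp

end

end Spinorial

theorem mainTheorem11 :
    (Nonempty (Matrix.GeneralLinearGroup (Fin 2) (GaloisField 2 2) ≃*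
        alternatingGroup (Fin 5) × Multiplicative (ZMod 3)) ∧
      ∀ (e : Matrix.GeneralLinearGroup (Fin 2) (GaloisField 2 2) ≃*
          alternatingGroup (Fin 5) × Multiplicative (ZMod 3))
        (V : Type*) [AddCommGroup V] [Module ℂ V] [FiniteDimensional ℂ V]
        (π : Representation ℂ (Matrix.GeneralLinearGroup (Fin 2) (GaloisField 2 2)) V)
        (Φ : LinearMap.BilinForm ℂ V) (hΦ : Φ.IsSymm),
        Φ.Nondegenerate → Spinorial.Preserves Φ π →
          (Spinorial.IsSpinorial Φ hΦ π ↔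
            ∃ k : ℤ, π.character 1 -
              π.character (e.symm (Spinorial.doubleTransposition 5 (by norm_num), 1)) =
                8 * (k : ℂ))) ∧
    (Nonempty (Matrix.GeneralLinearGroup (Fin 4) (ZMod 2) ≃* alternatingGroup (Fin 8)) ∧
      ∀ (e : Matrix.GeneralLinearGroup (Fin 4) (ZMod 2) ≃* alternatingGroup (Fin 8))
        (V : Type*) [AddCommGroup V] [Module ℂ V] [FiniteDimensional ℂ V]
        (π : Representation ℂ (Matrix.GeneralLinearGroup (Fin 4) (ZMod 2)) V)
        (Φ : LinearMap.BilinForm ℂ V) (hΦ : Φ.IsSymm),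
        Φ.Nondegenerate → Spinorial.Preserves Φ π →
          (Spinorial.IsSpinorial Φ hΦ π ↔
            ∃ k : ℤ, π.character 1 -
              π.character (e.symm (Spinorial.doubleTransposition 8 (by norm_num))) =
                8 * (k : ℂ))) := by
  refine ⟨⟨Spinorial.nonempty_mulEquiv_alternatingGroup_five_prod ?_, ?_⟩,
    Spinorial.nonempty_mulEquiv_alternatingGroup_eight, ?_⟩
  · rw [GaloisField.card 2 2 (by norm_num)]
    norm_num
  · intro e V _ _ _ π Φ hΦ hnd hπ
    exact Spinorial.isSpinorial_iff_of_mulEquiv_alternatingGroup_prod (by norm_num) e hΦ hnd hπ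
  · intro e V _ _ _ π Φ hΦ hnd hπ
    exact Spinorial.isSpinorial_iff_of_mulEquiv_alternatingGroup (by norm_num) e hΦ hnd hπ
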